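/- Let $T>0$, let $(\Omega,\mathcal F,\mathbb P)$ be a probability space and $(Z,\langle\cdot,\cdot\rangle)$ a separable real Hilbert space. Let $Q:Z\to Z$ be a non-negative self-adjoint nuclear operator, and let $W=(W_t)_{t\in[0,T]}$ be a $Z$-valued $Q$-Brownian motion, i.e. a $Z$-valued process with $W_0=0$, continuous paths and independent increments such that, for $0\le s<t\le T$, $W_t-W_s$ is centered Gaussian with covariance operator $(t-s)Q$, that is, $\mathbb E[e^{-\mathbf i\langle z,W_t-W_s\rangle}]=e^{-\frac12 (t-s)\langle Qz,z\rangle}$ for all $z\in Z$. Let $(\mathcal F_t)_{t\in[0,T]}$ be the usual $\mathbb P$-augmented filtration generated by $W$, i.e. the smallest filtration to which $W$ is adapted, which contains all $\mathbb P$-null sets and which is right-continuous on $[0,T)$. Let $(e_i)_{i\in I}$ be an orthonormal basis of $Z$ with $Qe_i=\lambda_i e_i$, $i \in I$, let $I_+:=\{i\in I:\lambda_i>0\}$, and for $i\in I_+$ put $W^{(i)}_t:=\lambda_i^{-1/2}\langle W_t,e_i\rangle$. Let $(g_j)_{j\in\mathbb N}$ be a.e. continuous functions on $[0,T]$ that form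 a complete orthonormal basis of $L^2([0,T],dt)$. For $i\in I_+$ and $j\in\mathbb N$ let $$\xi_{i,j}:=\int_0^T g_j(t)\,dW^{(i)}_t ,$$ the $L^2(\mathbb P)$-limit of the stochastic integrals of step functions converging to $g_j$ in $L^2([0,T],dt)$. Let $h_n(s):=(-1)^n e^{s^2/2}\frac{d^n}{ds^n}e^{-s^2/2}$, $n\in\mathbb N_0$, be the Hermite polynomials, let $\mathcal J$ be the set of all families $\alpha=(\alpha_{i,j})_{i\in I_+,\,j\in\mathbb N}$ in $\mathbb N_0$ with only finitely many non-zero entries, let $\alpha!:=\prod_{i,j}\alpha_{i,j}!$, and define the Wick polynomials $$\xi_\alpha:=\frac1{\sqrt{\alpha!}}\prod_{i,j}h_{\alpha_{i,j}}(\xi_{i,j}),\qquad \alpha\in\mathcal J .$$ Then, for every $p\in[1,\infty)$, the Wick polynomials belong to $L^p(\Omega,\mathcal F_T,\mathbb P)$ and the linear span of $(\xi_\alpha)_{\alpha\in\mathcal J}$ is dense in $L^p(\Omega,\mathcal F_T,\mathbb P)$. In particular, for $p=2$, the Wick polynomials $(\xi_\alpha)_{\alpha\in\mathcal J}$ form a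 complete orthonormal basis of $L^2(\Omega,\mathcal F_T,\mathbb P)$. -/

import Mathlib

open MeasureTheory ProbabilityTheory Filter
open scoped ENNReal Topology

noncomputable section

namespace WienerChaos

/-- A bounded operator `Q` on a Hilbert space is nuclear if `Q x = ∑ i, ⟪x, y i⟫ z i` for some
sequences `y`, `z` with `∑ i, ‖y i‖ ‖z i‖ < ∞`. -/
def IsNuclear {Z : Type*} [NormedAddCommGroup Z] [InnerProductSpace ℝ Z] (Q : Z →L[ℝ] Z) : Prop :=
  ∃ y z : ℕ → Z, Summable (fun i => ‖y i‖ * ‖z i‖) ∧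
    ∀ x : Z, HasSum (fun i => inner ℝ x (y i) • z i) (Q x)

/-- `G` is a centered Gaussian random variable with covariance operator `C`, in terms of its
Fourier transform. -/
def IsCenteredGaussian {Ω Z : Type*} {mΩ : MeasurableSpace Ω} [NormedAddCommGroup Z]
    [InnerProductSpace ℝ Z] (P : Measure Ω) (G : Ω → Z) (C : Z →L[ℝ] Z) : Prop :=
  ∀ z : Z, ∫ ω, Complex.exp (-(Complex.I * ((inner ℝ z (G ω) : ℝ) : ℂ))) ∂P =
    ((Real.exp (-(1 / 2) * inner ℝ (C z) z) : ℝ) : ℂ)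

/-- `W = (W_t)_{t ∈ [0,T]}` is a `Q`-Brownian motion: it starts in `0`, all its paths are continuous,
its increments are independent, and `W_t - W_s` is centered Gaussian with covariance operator
`(t - s) Q` for `0 ≤ s < t ≤ T`. -/
structure IsQBrownianMotion {Ω Z : Type*} {mΩ : MeasurableSpace Ω} [NormedAddCommGroup Z]
    [InnerProductSpace ℝ Z] [MeasurableSpace Z] {T : ℝ} (P : Measure Ω) (Q : Z →L[ℝ] Z)
    (W : Set.Icc (0 : ℝ) T → Ω → Z) : Prop where
  measurable : ∀ t, Measurable (W t)
  zero : ∀ t : Set.Icc (0 : ℝ) T, (t : ℝ) = 0 → ∀ ω, W t ω = 0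
  continuous : ∀ ω, Continuous (fun t => W t ω)
  indep : HasIndepIncrements W P
  gaussian : ∀ s t : Set.Icc (0 : ℝ) T, s < t →
    IsCenteredGaussian P (fun ω => W t ω - W s ω) (((t : ℝ) - (s : ℝ)) • Q)

/-- The filtration `σ(W_s : s ≤ t) ∨ σ(N : N a null set)`. -/
def completedFiltration {Ω Z : Type*} {mΩ : MeasurableSpace Ω} [mZ : MeasurableSpace Z] {T : ℝ}
    (P : Measure Ω) (W : Set.Icc (0 : ℝ) T → Ω → Z) (hW : ∀ t, Measurable (W t)) :
    Filtration (Set.Icc (0 : ℝ) T) mΩ where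
  seq t := (⨆ s ≤ t, mZ.comap (W s)) ⊔
    MeasurableSpace.generateFrom {N | MeasurableSet[mΩ] N ∧ P N = 0}
  mono' _ _ hst := sup_le_sup (biSup_mono fun _ h => h.trans hst) le_rfl
  le' _ := sup_le (iSup₂_le fun s _ => (hW s).comap_le)
    (MeasurableSpace.generateFrom_le fun _ h => h.1)

/-- The usual `P`-augmented filtration generated by `W`: `F_t = ⋂_{s > t} (σ(W_r : r ≤ s) ∨ 𝒩)` for
`t < T` and `F_T = σ(W_r : r ≤ T) ∨ 𝒩`, where `𝒩` is generated by the null sets. It is the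
smallest complete filtration that is right-continuous on `[0,T)` and to which `W` is adapted. -/
def augmentedFiltration {Ω Z : Type*} {mΩ : MeasurableSpace Ω} [MeasurableSpace Z] {T : ℝ}
    (P : Measure Ω) (W : Set.Icc (0 : ℝ) T → Ω → Z) (hW : ∀ t, Measurable (W t)) :
    Filtration (Set.Icc (0 : ℝ) T) mΩ :=
  (completedFiltration P W hW).rightCont

/-- A deterministic elementary integrand `∑ k, c_k 1_{(t_k, t_{k+1}]}` on `[0,T]`. -/
structure ElementaryIntegrand (T : ℝ) where
  n : ℕ
  t : Fin (n + 1) → Set.Icc (0 : ℝ) T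
  mono : Monotone t
  c : Fin n → ℝ

/-- The step function `∑ k, c_k 1_{(t_k, t_{k+1}]}`. -/
def ElementaryIntegrand.toFun {T : ℝ} (φ : ElementaryIntegrand T) (s : ℝ) : ℝ :=
  ∑ k : Fin φ.n,
    (Set.Ioc (φ.t k.castSucc : ℝ) (φ.t k.succ : ℝ)).indicator (fun _ => φ.c k) s

/-- The elementary stochastic integral `∑ k, c_k (B_{t_{k+1}} - B_{t_k})`. -/
def ElementaryIntegrand.integral {Ω : Type*} {T : ℝ} (φ : ElementaryIntegrand T)
    (B : Set.Icc (0 : ℝ) T → Ω → ℝ) (ω : Ω) : ℝ :=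
  ∑ k : Fin φ.n, φ.c k * (B (φ.t k.succ) ω - B (φ.t k.castSucc) ω)

/-- `X` is (a version of) `∫_0^T g(t) dB_t`: it is the `L²(P)`-limit of the elementary stochastic
integrals of elementary integrands that converge to `g` in `L²([0,T])`. -/
def IsStochasticIntegral {Ω : Type*} {mΩ : MeasurableSpace Ω} {T : ℝ} (P : Measure Ω)
    (B : Set.Icc (0 : ℝ) T → Ω → ℝ) (g : ℝ → ℝ) (X : Ω → ℝ) : Prop :=
  MemLp X 2 P ∧ ∃ φ : ℕ → ElementaryIntegrand T,
    Tendsto (fun m => eLpNorm (fun s => (φ m).toFun s - g s) 2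
      (volume.restrict (Set.Icc (0 : ℝ) T))) atTop (𝓝 0) ∧
    Tendsto (fun m => eLpNorm (fun ω => (φ m).integral B ω - X ω) 2 P) atTop (𝓝 0)

open Classical in
/-- The stochastic integral `∫_0^T g(t) dB_t` (defined up to null sets; a version is chosen, and the
value is `0` if the integral does not exist). -/
def stochasticIntegral {Ω : Type*} {mΩ : MeasurableSpace Ω} {T : ℝ} (P : Measure Ω)
    (B : Set.Icc (0 : ℝ) T → Ω → ℝ) (g : ℝ → ℝ) : Ω → ℝ :=
  if h : ∃ X : Ω → ℝ, IsStochasticIntegral P B g X then h.choose else 0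

/-- The coordinate process `W^{(i)}_t = λ_i^{-1/2} ⟪W_t, e_i⟫`, for `λ = λ_i` and `e = e_i`. -/
def coordProcess {Ω Z : Type*} [NormedAddCommGroup Z] [InnerProductSpace ℝ Z] {T : ℝ}
    (W : Set.Icc (0 : ℝ) T → Ω → Z) (lam : ℝ) (e : Z) (t : Set.Icc (0 : ℝ) T) (ω : Ω) : ℝ :=
  (1 / Real.sqrt lam) * inner ℝ (W t ω) e

/-- The Hermite polynomials `h_n(s) = (-1)^n e^{s²/2} (dⁿ/dsⁿ) e^{-s²/2}`. -/
def hermiteFun (n : ℕ) (s : ℝ) : ℝ :=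
  (-1) ^ n * Real.exp (s ^ 2 / 2) * iteratedDeriv n (fun x : ℝ => Real.exp (-(x ^ 2 / 2))) s

/-- `α! = ∏ α_k!` for a finitely supported multi-index `α`. -/
def multiFactorial {κ : Type*} (α : κ →₀ ℕ) : ℕ := α.prod fun _ n => n.factorial

/-- The Wick polynomial `(α!)^{-1/2} ∏_k h_{α_k}(ξ_k)` of a family `ξ` of random variables. The
product runs over the support of `α`; the other factors are `h_0 = 1`. -/
def wickPolynomial {Ω κ : Type*} (ξ : κ → Ω → ℝ) (α : κ →₀ ℕ) (ω : Ω) : ℝ :=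
  (1 / Real.sqrt (multiFactorial α : ℝ)) * α.prod fun k n => hermiteFun n (ξ k ω)

/-- The random variables `ξ_{i,j} = ∫_0^T g_j(t) dW^{(i)}_t`, for the indices `i` with `λ_i > 0`. -/
def gaussianCoord {Ω Z ι : Type*} {mΩ : MeasurableSpace Ω} [NormedAddCommGroup Z]
    [InnerProductSpace ℝ Z] {T : ℝ} (P : Measure Ω) (W : Set.Icc (0 : ℝ) T → Ω → Z)
    (lam : ι → ℝ) (e : ι → Z) (g : ℕ → ℝ → ℝ) (k : {i : ι // 0 < lam i} × ℕ) : Ω → ℝ :=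
  stochasticIntegral P (coordProcess W (lam k.1) (e k.1)) (g k.2)

end WienerChaos

end

/-! Density rests on a Gaussian monomial-to-exponential argument. Let `V` be the closure in `L^p` of
the span of the Wick polynomials. The recurrence `s h_n(s) = h_{n+1}(s) + n h_{n-1}(s)` makes the
span stable under multiplication by each `ξ_k`, so it contains all powers of a finite linear
combination `u` of the `ξ_k`. The Taylor sums of `cos u` and `sin u` are dominated by `cosh u`,
which has all moments, so `cos u` and `sin u` lie in `V`. Both functions are bounded, so this passes
to a.e. limits, hence to every `u` in the closed `L²`-span of the `ξ_k`
(`cos_sin_mem_of_mem_gaussianSpace`). Trigonometric polynomials in such `u` form an algebra of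
bounded functions, and a monotone class argument (`lpMeas_le_of_subalgebra`) puts into `V` every
`L^p` function measurable with respect to these `u`.

These `u` generate the terminal σ-algebra. The deterministic Itô isometry and the completeness of
`(g_j)` recover `⟪e_i, W_t⟫` from the `ξ_{i,j}` when `λ_i > 0`. When `λ_i = 0` this coordinate
vanishes a.s., and the indicator of a null set is a.e. zero as well.

For orthonormality, the `ξ_{i,j}` are orthonormal by the isometry and lie in the Gaussian space of
`W`. They are therefore independent standard normals (`iIndepFun_of_mem_gaussianSpace`), and the
expectation of a product of two Wick polynomials factors into one-dimensional Hermite integrals. -/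

namespace WienerChaos

/-! ### Closed subspaces of `L^p` and the monotone class argument -/

section Density

variable {Ω : Type*} {mΩ : MeasurableSpace Ω} {P : Measure Ω} {p : ℝ≥0∞}

/-- Dominated convergence in `L^p`. -/
theorem tendsto_eLpNorm_sub_of_dominated (hp0 : p ≠ 0) (hp : p ≠ ∞) {F : ℕ → Ω → ℝ} {f h : Ω → ℝ}
    (hF : ∀ n, AEStronglyMeasurable (F n) P) (hh : MemLp h p P)
    (hbound : ∀ n, ∀ᵐ ω ∂P, |F n ω| ≤ h ω)
    (hlim : ∀ᵐ ω ∂P, Tendsto (fun n => F n ω) atTop (𝓝 (f ω))) :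
    Tendsto (fun n => eLpNorm (F n - f) p P) atTop (𝓝 0) := by
  have hf : AEStronglyMeasurable f P := aestronglyMeasurable_of_tendsto_ae atTop hF hlim
  have hfb : ∀ᵐ ω ∂P, |f ω| ≤ h ω := by
    filter_upwards [hlim, ae_all_iff.2 hbound] with ω h1 h2
    exact le_of_tendsto h1.abs (Eventually.of_forall h2)
  have hp' : 0 < p.toReal := ENNReal.toReal_pos hp0 hp
  have h2 : MemLp (fun ω => 2 * h ω) p P := hh.const_mul 2
  have key : Tendsto (fun n => ∫⁻ ω, ‖(F n - f) ω‖ₑ ^ p.toReal ∂P) atTop (𝓝 (∫⁻ _, 0 ∂P)) := by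
    refine tendsto_lintegral_of_dominated_convergence' (fun ω => ‖2 * h ω‖ₑ ^ p.toReal)
      (fun n => (((hF n).sub hf).enorm).pow_const _) (fun n => ?_) ?_ ?_
    · filter_upwards [hfb, hbound n] with ω h1 h2
      refine ENNReal.rpow_le_rpow ?_ hp'.le
      rw [Pi.sub_apply, enorm_le_iff_norm_le, Real.norm_eq_abs, Real.norm_eq_abs]
      calc |F n ω - f ω| ≤ |F n ω| + |f ω| := abs_sub _ _
        _ ≤ 2 * h ω := by linarith
        _ ≤ |2 * h ω| := le_abs_self _
    · exact (lintegral_rpow_enorm_lt_top_of_eLpNorm_lt_top hp0 hp h2.2).ne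
    · filter_upwards [hlim] with ω h1
      have h3 : Tendsto (fun n => F n ω - f ω) atTop (𝓝 0) := by
        simpa using h1.sub_const (f ω)
      have h4 := (ENNReal.continuous_rpow_const (y := p.toReal)).tendsto 0 |>.comp
        (by simpa using h3.enorm : Tendsto (fun n => ‖F n ω - f ω‖ₑ) atTop (𝓝 0))
      simpa [Function.comp_def, hp'] using h4
  simp only [lintegral_zero] at key
  have h5 := (ENNReal.continuous_rpow_const (y := 1 / p.toReal)).tendsto 0 |>.comp key
  rw [ENNReal.zero_rpow_of_pos (by positivity)] at h5
  refine h5.congr fun n => ?_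
  rw [eLpNorm_eq_lintegral_rpow_enorm_toReal hp0 hp]
  rfl

/-- The functions that are a.e. equal to an element of `V`. -/
def aeSubmodule (V : Submodule ℝ (Lp ℝ p P)) : Submodule ℝ (Ω → ℝ) where
  carrier := {f | ∃ v ∈ V, v =ᵐ[P] f}
  zero_mem' := ⟨0, V.zero_mem, Lp.coeFn_zero _ _ _⟩
  add_mem' := by
    rintro f g ⟨v, hv, hvf⟩ ⟨w, hw, hwg⟩
    exact ⟨v + w, V.add_mem hv hw, (Lp.coeFn_add v w).trans (hvf.add hwg)⟩
  smul_mem' := by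
    rintro c f ⟨v, hv, hvf⟩
    exact ⟨c • v, V.smul_mem c hv, (Lp.coeFn_smul c v).trans (hvf.const_smul c)⟩

variable {V : Submodule ℝ (Lp ℝ p P)}

theorem memLp_of_mem_aeSubmodule {f : Ω → ℝ} (hf : f ∈ aeSubmodule V) : MemLp f p P := by
  obtain ⟨v, -, hv⟩ := hf
  exact (memLp_congr_ae hv).1 (Lp.memLp v)

theorem toLp_mem_of_mem_aeSubmodule {f : Ω → ℝ} (hf : f ∈ aeSubmodule V) (h : MemLp f p P) :
    h.toLp f ∈ V := by
  obtain ⟨v, hv, hvf⟩ := hf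
  have : h.toLp f = v := Lp.ext (h.coeFn_toLp.trans hvf.symm)
  rwa [this]

theorem mem_aeSubmodule_of_toLp_mem {f : Ω → ℝ} (h : MemLp f p P) (hf : h.toLp f ∈ V) :
    f ∈ aeSubmodule V := ⟨_, hf, h.coeFn_toLp⟩

theorem coeFn_mem_aeSubmodule {v : Lp ℝ p P} : (v : Ω → ℝ) ∈ aeSubmodule V ↔ v ∈ V := by
  refine ⟨fun ⟨w, hw, h⟩ => ?_, fun h => ⟨v, h, EventuallyEq.rfl⟩⟩
  rwa [← Lp.ext h]

theorem mem_aeSubmodule_congr {f g : Ω → ℝ} (hf : f ∈ aeSubmodule V) (h : f =ᵐ[P] g) :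
    g ∈ aeSubmodule V := by
  obtain ⟨v, hv, hvf⟩ := hf
  exact ⟨v, hv, hvf.trans h⟩

theorem mem_aeSubmodule_of_tendsto_eLpNorm [Fact (1 ≤ p)] (hV : IsClosed (V : Set (Lp ℝ p P)))
    {F : ℕ → Ω → ℝ} {f : Ω → ℝ} (hF : ∀ n, F n ∈ aeSubmodule V) (hf : MemLp f p P)
    (hlim : Tendsto (fun n => eLpNorm (F n - f) p P) atTop (𝓝 0)) : f ∈ aeSubmodule V := by
  refine mem_aeSubmodule_of_toLp_mem hf ?_
  have h := (Lp.tendsto_Lp_iff_tendsto_eLpNorm'' F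
    (fun n => memLp_of_mem_aeSubmodule (hF n)) f hf).2 hlim
  exact hV.mem_of_tendsto h
    (Eventually.of_forall fun n => toLp_mem_of_mem_aeSubmodule (hF n) _)

theorem mem_aeSubmodule_of_dominated [Fact (1 ≤ p)] (hp : p ≠ ∞)
    (hV : IsClosed (V : Set (Lp ℝ p P)))
    {F : ℕ → Ω → ℝ} {f h : Ω → ℝ} (hF : ∀ n, F n ∈ aeSubmodule V) (hh : MemLp h p P)
    (hbound : ∀ n, ∀ᵐ ω ∂P, |F n ω| ≤ h ω)
    (hlim : ∀ᵐ ω ∂P, Tendsto (fun n => F n ω) atTop (𝓝 (f ω))) : f ∈ aeSubmodule V := by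
  have hFm : ∀ n, AEStronglyMeasurable (F n) P := fun n => (memLp_of_mem_aeSubmodule (hF n)).1
  refine mem_aeSubmodule_of_tendsto_eLpNorm hV hF
    (hh.mono (aestronglyMeasurable_of_tendsto_ae atTop hFm hlim) ?_)
    (tendsto_eLpNorm_sub_of_dominated (zero_lt_one.trans_le Fact.out).ne' hp hFm hh hbound hlim)
  filter_upwards [hlim, ae_all_iff.2 hbound] with ω h1 h2
  exact (le_of_tendsto h1.abs (Eventually.of_forall h2)).trans (le_abs_self _)

/-- The sets whose indicator is a bounded pointwise limit of a sequence in `A`. -/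
def limitSets (A : Subalgebra ℝ (Ω → ℝ)) : Set (Set Ω) :=
  {s | ∃ F : ℕ → Ω → ℝ, (∀ n, F n ∈ A) ∧ (∃ C, ∀ n ω, |F n ω| ≤ C) ∧
    ∀ ω, Tendsto (fun n => F n ω) atTop (𝓝 (s.indicator (fun _ => 1) ω))}

/-- Indicators multiply under intersection, and products of uniformly bounded approximating
sequences stay in the algebra and stay uniformly bounded. -/
theorem isPiSystem_limitSets (A : Subalgebra ℝ (Ω → ℝ)) : IsPiSystem (limitSets A) := by
  rintro s ⟨F, hF, ⟨C, hC⟩, hlim⟩ t ⟨G, hG, ⟨D, hD⟩, hlim'⟩ -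
  refine ⟨fun n => F n * G n, fun n => A.mul_mem (hF n) (hG n), ⟨C * D, fun n ω => ?_⟩,
    fun ω => ?_⟩
  · change |F n ω * G n ω| ≤ C * D
    rw [abs_mul]
    exact mul_le_mul (hC n ω) (hD n ω) (abs_nonneg _) ((abs_nonneg _).trans (hC n ω))
  · have h2 : (s ∩ t).indicator (fun _ => (1 : ℝ)) ω
        = s.indicator (fun _ => (1 : ℝ)) ω * t.indicator (fun _ => (1 : ℝ)) ω := by
      by_cases h1 : ω ∈ s <;> by_cases h2 : ω ∈ t <;> simp [h1, h2]
    rw [h2]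
    exact (hlim ω).mul (hlim' ω)

theorem eval_comp_mem {A : Subalgebra ℝ (Ω → ℝ)} {f : Ω → ℝ} (hf : f ∈ A) (q : Polynomial ℝ) :
    (fun ω => q.eval (f ω)) ∈ A := by
  have h1 : (fun ω => q.eval (f ω)) = Polynomial.aeval f q := by
    ext ω
    simp
  rw [h1]
  exact Algebra.adjoin_le (by simpa using hf) (Polynomial.aeval_mem_adjoin_singleton ℝ f)

/-- The ramps `min 1 (n (x - a)⁺)` increase to the indicator of `x > a`. By Weierstrass they can be
replaced by polynomials on `[-M, M]`, and polynomials in `f` remain in the algebra. -/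
theorem superlevel_mem_limitSets {A : Subalgebra ℝ (Ω → ℝ)} {f : Ω → ℝ} (hf : f ∈ A) {M : ℝ}
    (hM : ∀ ω, |f ω| ≤ M) (a : ℝ) : f ⁻¹' Set.Ioi a ∈ limitSets A := by
  let φ : ℕ → ℝ → ℝ := fun n x => min 1 (n * max (x - a) 0)
  have hφ : ∀ n, Continuous (φ n) := fun n => by fun_prop
  have hφ0 : ∀ n x, 0 ≤ φ n x := fun n x => by positivity
  have hφ1 : ∀ n x, φ n x ≤ 1 := fun n x => min_le_left _ _
  have hex : ∀ n : ℕ, ∃ q : Polynomial ℝ, ∀ x ∈ Set.Icc (-M) M, |q.eval x - φ n x| < 1 / (n + 1) :=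
    fun n => exists_polynomial_near_of_continuousOn _ _ _ (hφ n).continuousOn _ (by positivity)
  choose q hq using hex
  have hmem : ∀ ω, f ω ∈ Set.Icc (-M) M := fun ω => abs_le.1 (hM ω)
  -- The bound `2` is the ramp's maximum `1` plus an approximation error of at most `1`.
  refine ⟨fun n ω => (q n).eval (f ω), fun n => eval_comp_mem hf (q n), ⟨2, fun n ω => ?_⟩, fun ω => ?_⟩
  · have h1 := hq n (f ω) (hmem ω)
    have h2 : (1 : ℝ) / (n + 1) ≤ 1 := by
      rw [div_le_one (by positivity)]; linarith [(n.cast_nonneg : (0 : ℝ) ≤ n)]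
    have h3 := hφ0 n (f ω)
    have h4 := hφ1 n (f ω)
    rw [abs_lt] at h1
    rw [abs_le]
    constructor <;> linarith
  · have h1 : Tendsto (fun n => (q n).eval (f ω) - φ n (f ω)) atTop (𝓝 0) :=
      squeeze_zero_norm (fun n => (hq n (f ω) (hmem ω)).le) tendsto_one_div_add_atTop_nhds_zero_nat
    have h2 : Tendsto (fun n => φ n (f ω)) atTop
        (𝓝 ((f ⁻¹' Set.Ioi a).indicator (fun _ => 1) ω)) := by
      by_cases h : a < f ω
      · rw [Set.indicator_of_mem (by simpa using h)]
        have h3 : Tendsto (fun n : ℕ => (n : ℝ) * max (f ω - a) 0) atTop atTop :=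
          tendsto_natCast_atTop_atTop.atTop_mul_const (lt_max_of_lt_left (sub_pos.2 h))
        refine tendsto_const_nhds.congr' ?_
        filter_upwards [h3.eventually_ge_atTop 1] with n hn
        exact (min_eq_left hn).symm
      · rw [Set.indicator_of_notMem (by simpa using h)]
        have : ∀ n, φ n (f ω) = 0 := fun n => by
          simp only [φ]
          rw [max_eq_right (by linarith)]; simp
        simp [this]
    simpa using h1.add h2

/-- Dynkin's π-λ theorem: sets with indicator in `V` are stable under complements because `1 ∈ V`,
and under disjoint countable unions by dominated convergence and closedness. -/
theorem indicator_mem_aeSubmodule_of_isPiSystem [IsFiniteMeasure P] [Fact (1 ≤ p)] (hp : p ≠ ∞)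
    (hV : IsClosed (V : Set (Lp ℝ p P))) {C : Set (Set Ω)} (hC : IsPiSystem C)
    (hone : (fun _ => (1 : ℝ)) ∈ aeSubmodule V)
    (hCV : ∀ t ∈ C, MeasurableSet t ∧ t.indicator (fun _ => (1 : ℝ)) ∈ aeSubmodule V) {s : Set Ω}
    (hs : MeasurableSet[MeasurableSpace.generateFrom C] s) :
    MeasurableSet s ∧ s.indicator (fun _ => (1 : ℝ)) ∈ aeSubmodule V := by
  refine MeasurableSpace.induction_on_inter
    (C := fun s _ => MeasurableSet s ∧ s.indicator (fun _ => (1 : ℝ)) ∈ aeSubmodule V) rfl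
    hC ?_ hCV ?_ ?_ s hs
  · exact ⟨.empty, by rw [Set.indicator_empty]; exact (aeSubmodule V).zero_mem⟩
  · rintro t - ⟨h1, h2⟩
    refine ⟨h1.compl, ?_⟩
    have : tᶜ.indicator (fun _ => (1 : ℝ)) = (fun _ => (1 : ℝ)) - t.indicator (fun _ => (1 : ℝ)) := by
      ext ω; by_cases h : ω ∈ t <;> simp [h]
    rw [this]
    exact (aeSubmodule V).sub_mem hone h2
  · intro f hd _ hf
    refine ⟨MeasurableSet.iUnion fun i => (hf i).1, ?_⟩
    have hsum : ∀ n : ℕ, (⋃ i ∈ Finset.range n, f i).indicator (fun _ => (1 : ℝ))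
        = ∑ i ∈ Finset.range n, (f i).indicator (fun _ => (1 : ℝ)) := fun n => by
      ext ω
      rw [Finset.indicator_biUnion_apply _ _ (fun i _ j _ hij => hd hij), Finset.sum_apply]
    refine mem_aeSubmodule_of_dominated hp hV
      (F := fun n => (⋃ i ∈ Finset.range n, f i).indicator (fun _ => (1 : ℝ)))
      (fun n => ?_) (memLp_const 1)
      (fun n => ae_of_all _ fun ω => ?_) (ae_of_all _ fun ω => ?_)
    · rw [hsum]
      exact (aeSubmodule V).sum_mem fun i _ => (hf i).2
    · simp only [Set.indicator]; split_ifs <;> simp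
    · by_cases h : ω ∈ ⋃ i, f i
      · obtain ⟨i, hi⟩ := Set.mem_iUnion.1 h
        rw [Set.indicator_of_mem h]
        refine tendsto_const_nhds.congr' ?_
        filter_upwards [eventually_gt_atTop i] with n hn
        rw [Set.indicator_of_mem]
        exact Set.mem_biUnion (by simpa using hn) hi
      · rw [Set.indicator_of_notMem h]
        refine tendsto_const_nhds.congr fun n => ?_
        rw [Set.indicator_of_notMem]
        simp only [Set.mem_iUnion, not_exists] at h ⊢
        exact fun i _ => h i

/-- A closed subspace of `L^p` that contains the indicators of all `m`-measurable sets contains all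
`m`-measurable functions. -/
theorem lpMeas_le_of_indicator_mem {Ω : Type*} {m mΩ : MeasurableSpace Ω} {P : Measure Ω}
    {p : ℝ≥0∞} {V : Submodule ℝ (Lp ℝ p P)} [Fact (1 ≤ p)] (hp : p ≠ ∞)
    (hV : IsClosed (V : Set (Lp ℝ p P)))
    (hind : ∀ s, MeasurableSet[m] s →
      MeasurableSet[mΩ] s ∧ s.indicator (fun _ => (1 : ℝ)) ∈ aeSubmodule V) :
    lpMeas ℝ ℝ m p P ≤ V := by
  have hmΩ : m ≤ mΩ := fun s hs => (hind s hs).1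
  intro f hf
  refine Lp.induction_stronglyMeasurable hmΩ hp (fun f => f ∈ V) ?_ ?_ ?_ f
    (mem_lpMeas_iff_aestronglyMeasurable.1 hf)
  · intro c s hs hμs
    rw [← coeFn_mem_aeSubmodule]
    have h1 := (aeSubmodule V).smul_mem c (hind s hs).2
    refine mem_aeSubmodule_congr h1 ?_
    rw [Lp.simpleFunc.coe_indicatorConst]
    refine EventuallyEq.trans (EventuallyEq.of_eq ?_) indicatorConstLp_coeFn.symm
    ext ω; by_cases h : ω ∈ s <;> simp [h]
  · intro f g hf hg _ _ _ h1 h2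
    exact V.add_mem h1 h2
  · exact hV.preimage continuous_subtype_val

/-- A closed subspace of `L^p` that contains an algebra `A` of bounded functions contains all
functions of `L^p` that are measurable with respect to `A`. -/
theorem lpMeas_le_of_subalgebra {Ω : Type*} {m mΩ : MeasurableSpace Ω} {P : Measure Ω}
    {p : ℝ≥0∞} {V : Submodule ℝ (Lp ℝ p P)} [IsFiniteMeasure P] [Fact (1 ≤ p)] (hp : p ≠ ∞)
    (hV : IsClosed (V : Set (Lp ℝ p P))) (A : Subalgebra ℝ (Ω → ℝ))
    (hmeas : ∀ f ∈ A, Measurable f) (hbdd : ∀ f ∈ A, ∃ M, ∀ ω, |f ω| ≤ M)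
    (hAV : ∀ f ∈ A, f ∈ aeSubmodule V)
    (hm : m ≤ ⨆ f ∈ A, MeasurableSpace.comap f inferInstance) : lpMeas ℝ ℝ m p P ≤ V := by
  have hm' : m ≤ MeasurableSpace.generateFrom (limitSets A) := by
    refine hm.trans (iSup₂_le fun f hf => ?_)
    obtain ⟨M, hM⟩ := hbdd f hf
    rw [← measurable_iff_comap_le]
    let _ : MeasurableSpace Ω := MeasurableSpace.generateFrom (limitSets A)
    exact measurable_of_Ioi fun a => MeasurableSpace.measurableSet_generateFrom
      (superlevel_mem_limitSets hf hM a)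
  refine lpMeas_le_of_indicator_mem hp hV fun s hs => indicator_mem_aeSubmodule_of_isPiSystem hp hV
    (isPiSystem_limitSets A) (hAV _ A.one_mem) ?_ (hm' s hs)
  rintro t ⟨F, hF, ⟨C, hC⟩, hlim⟩
  constructor
  · have h1 : Measurable (t.indicator fun _ => (1 : ℝ)) :=
      measurable_of_tendsto_metrizable (fun n => hmeas _ (hF n)) (tendsto_pi_nhds.2 hlim)
    rwa [measurable_indicator_const_iff] at h1
  · exact mem_aeSubmodule_of_dominated hp hV (fun n => hAV _ (hF n)) (memLp_const C)
      (fun n => ae_of_all _ (hC n)) (ae_of_all _ hlim)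

end Density

/-! ### Hermite polynomials and the standard Gaussian measure -/

section Hermite

open Polynomial

theorem hermiteFun_eq_eval (n : ℕ) (s : ℝ) :
    hermiteFun n s = ((hermite n).map (Int.castRingHom ℝ)).eval s := by
  rw [hermiteFun, iteratedDeriv_eq_iterate, eval_map, ← algebraMap_int_eq, ← aeval_def,
    hermite_eq_deriv_gaussian']
  ring

@[simp]
theorem hermiteFun_zero (s : ℝ) : hermiteFun 0 s = 1 := by
  simp [hermiteFun_eq_eval]

/-- The Hermite polynomials over `ℝ`. -/
noncomputable def hermitePoly (n : ℕ) : ℝ[X] := (hermite n).map (Int.castRingHom ℝ)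

theorem hermitePoly_succ (n : ℕ) :
    hermitePoly (n + 1) = X * hermitePoly n - derivative (hermitePoly n) := by
  simp [hermitePoly, hermite_succ, derivative_map]

theorem hermitePoly_zero : hermitePoly 0 = 1 := by simp [hermitePoly]

theorem derivative_hermitePoly (n : ℕ) :
    derivative (hermitePoly n) = (n : ℝ[X]) * hermitePoly (n - 1) := by
  induction n with
  | zero => simp [hermitePoly_zero]
  | succ n ih =>
    rw [hermitePoly_succ, map_sub, derivative_mul, derivative_X, ih, derivative_mul]
    cases n with
    | zero => simp [hermitePoly_zero]
    | succ m =>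
      simp only [Nat.add_sub_cancel] at ih ⊢
      rw [hermitePoly_succ m, derivative_natCast]
      push_cast
      ring

/-- The rule `H_{n+1} = X H_n - H_n'` combined with `H_n' = n H_{n-1}`. At `n = 0` the truncated
index `n - 1` is harmless because its coefficient is zero. -/
theorem hermiteFun_mul_id (n : ℕ) (s : ℝ) :
    s * hermiteFun n s = hermiteFun (n + 1) s + n * hermiteFun (n - 1) s := by
  have h := congrArg (eval s) (hermitePoly_succ n)
  rw [derivative_hermitePoly] at h
  simp only [eval_sub, eval_mul, eval_X, eval_natCast] at h
  simp only [hermiteFun_eq_eval]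
  change s * (hermitePoly n).eval s
    = (hermitePoly (n + 1)).eval s + n * (hermitePoly (n - 1)).eval s
  rw [h]; ring

theorem measurable_hermiteFun (n : ℕ) : Measurable (hermiteFun n) := by
  have : hermiteFun n = fun s => (hermitePoly n).eval s := funext (hermiteFun_eq_eval n)
  rw [this]
  exact (Polynomial.continuous _).measurable

theorem memLp_eval_gaussianReal (q : ℝ[X]) {p : ℝ≥0∞} (hp : p ≠ ∞) :
    MemLp (fun x => q.eval x) p (gaussianReal 0 1) := by
  induction q using Polynomial.induction_on' with
  | add p q hp hq =>
    simp only [eval_add]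
    exact hp.add hq
  | monomial n a =>
    simp only [eval_monomial]
    refine MemLp.const_mul ?_ a
    -- For `n > 0` the identity is in `L^{pn}`, so its `n`-th power is in `L^p`; cancelling `n` in
    -- the exponent excludes `n = 0`.
    rcases Nat.eq_zero_or_pos n with rfl | hn
    · simpa using memLp_const (1 : ℝ)
    have h := (memLp_id_gaussianReal' (μ := 0) (v := 1) (p * n)
      (ENNReal.mul_ne_top hp (ENNReal.natCast_ne_top n))).norm_rpow_div (n : ℝ≥0∞)
    rw [ENNReal.mul_div_cancel_right (by simpa using hn.ne') (ENNReal.natCast_ne_top n)] at h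
    refine h.mono (by fun_prop) (ae_of_all _ fun x => ?_)
    simp

theorem integrable_eval_gaussianReal (q : ℝ[X]) :
    Integrable (fun x => q.eval x) (gaussianReal 0 1) :=
  memLp_one_iff_integrable.1 (memLp_eval_gaussianReal q ENNReal.one_ne_top)

theorem integrable_eval_mul_gaussianPDFReal (q : ℝ[X]) :
    Integrable (fun x => q.eval x * gaussianPDFReal 0 1 x) := by
  have h := integrable_eval_gaussianReal q
  rw [gaussianReal_of_var_ne_zero 0 one_ne_zero,
    integrable_withDensity_iff_integrable_smul' (measurable_gaussianPDF 0 1)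
      (ae_of_all _ fun _ => gaussianPDF_lt_top)] at h
  refine h.congr (ae_of_all _ fun x => ?_)
  simp [toReal_gaussianPDF, mul_comm]

/-- Gaussian integration by parts. -/
theorem integral_X_mul_gaussianReal (q : ℝ[X]) :
    ∫ x, (X * q - derivative q).eval x ∂(gaussianReal 0 1) = 0 := by
  rw [integral_gaussianReal_eq_integral_smul one_ne_zero]
  have hd : ∀ x, HasDerivAt (fun x => -(q.eval x * gaussianPDFReal 0 1 x))
      (gaussianPDFReal 0 1 x • (X * q - derivative q).eval x) x := fun x => by
    have h1 : HasDerivAt (fun x => gaussianPDFReal 0 1 x) (-x * gaussianPDFReal 0 1 x) x := by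
      simp only [gaussianPDFReal_def, NNReal.coe_one, mul_one, sub_zero]
      have h2 : HasDerivAt (fun x : ℝ => -x ^ 2 / 2) (-x) x := by
        have := ((hasDerivAt_pow 2 x).neg).div_const 2
        convert! this using 1
        norm_num
        ring
      convert! (h2.exp.const_mul (√(2 * Real.pi))⁻¹) using 1
      ring
    convert! ((q.hasDerivAt x).mul h1).neg using 1
    simp
    ring
  refine integral_eq_zero_of_hasDerivAt_of_integrable hd ?_
    (integrable_eval_mul_gaussianPDFReal q).neg
  refine (integrable_eval_mul_gaussianPDFReal (X * q - derivative q)).congr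
    (ae_of_all _ fun x => ?_)
  simp [mul_comm]

/-- Integration by parts applied to `H_n q`: raising the Hermite index is adjoint to
differentiation. Iterating this gives orthogonality and the norm `n!`. -/
theorem integral_hermitePoly_succ_mul (n : ℕ) (q : ℝ[X]) :
    ∫ x, (hermitePoly (n + 1) * q).eval x ∂(gaussianReal 0 1)
      = ∫ x, (hermitePoly n * derivative q).eval x ∂(gaussianReal 0 1) := by
  rw [← sub_eq_zero, ← integral_sub (integrable_eval_gaussianReal _)
    (integrable_eval_gaussianReal _)]
  refine Eq.trans (integral_congr_ae (ae_of_all _ fun x => ?_))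
    (integral_X_mul_gaussianReal (hermitePoly n * q))
  beta_reduce
  rw [← eval_sub]
  congr 1
  rw [hermitePoly_succ, derivative_mul]
  ring

theorem integral_hermitePoly_mul (n m : ℕ) :
    ∫ x, (hermitePoly n * hermitePoly m).eval x ∂(gaussianReal 0 1)
      = if n = m then (n.factorial : ℝ) else 0 := by
  induction n generalizing m with
  | zero =>
    cases m with
    | zero => simp [hermitePoly_zero]
    | succ m =>
      rw [mul_comm, integral_hermitePoly_succ_mul, hermitePoly_zero]
      simp
  | succ n ih =>
    rw [integral_hermitePoly_succ_mul, derivative_hermitePoly]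
    cases m with
    | zero => simp
    | succ m =>
      have h1 : ∀ x, (hermitePoly n * (((m + 1 : ℕ) : ℝ[X]) * hermitePoly (m + 1 - 1))).eval x
          = ((m + 1 : ℕ) : ℝ) * (hermitePoly n * hermitePoly m).eval x := fun x => by
        simp only [eval_mul, eval_natCast, Nat.add_sub_cancel]; ring
      simp only [h1, integral_const_mul, ih, Nat.add_right_cancel_iff]
      split_ifs with h
      · subst h
        rw [Nat.factorial_succ]; push_cast; ring
      · simp

theorem integral_hermiteFun_mul (n m : ℕ) :
    ∫ x, hermiteFun n x * hermiteFun m x ∂(gaussianReal 0 1)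
      = if n = m then (n.factorial : ℝ) else 0 := by
  rw [← integral_hermitePoly_mul]
  simp only [hermiteFun_eq_eval, eval_mul]
  rfl

end Hermite

/-! ### Random variables with all moments -/

section Moments

variable {Ω : Type*} {mΩ : MeasurableSpace Ω}

/-- The algebra of random variables with finite moments of all orders. -/
def momentAlgebra (P : Measure Ω) [IsFiniteMeasure P] : Subalgebra ℝ (Ω → ℝ) where
  carrier := {f | ∀ p : ℝ≥0∞, p ≠ ∞ → MemLp f p P}
  mul_mem' := by
    intro f g hf hg p hp
    have h2 : (2 : ℝ≥0∞) * p ≠ ∞ := ENNReal.mul_ne_top ENNReal.ofNat_ne_top hp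
    -- Hölder with `1/(2p) + 1/(2p) = 1/p`: a product costs a doubling of the exponent, which is
    -- affordable when all moments exist.
    have : ENNReal.HolderTriple (2 * p) (2 * p) p := ⟨by
      rw [ENNReal.mul_inv (Or.inl two_ne_zero) (Or.inl ENNReal.ofNat_ne_top), ← add_mul,
        ENNReal.inv_two_add_inv_two, one_mul]⟩
    exact (hg _ h2).mul (hf _ h2)
  add_mem' := fun hf hg p hp => (hf p hp).add (hg p hp)
  algebraMap_mem' := fun r _ _ => memLp_const r

theorem comp_mem_momentAlgebra {P : Measure Ω} [IsFiniteMeasure P] {X : Ω → ℝ}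
    (hX : AEMeasurable X P) {φ : ℝ → ℝ} (hφ : Measurable φ)
    (h : ∀ p : ℝ≥0∞, p ≠ ∞ → MemLp φ p (P.map X)) : (fun ω => φ (X ω)) ∈ momentAlgebra P :=
  fun p hp => (memLp_map_measure_iff hφ.aestronglyMeasurable hX).1 (h p hp)

theorem memLp_exp_mul_gaussianReal (t : ℝ) {p : ℝ≥0∞} (hp : p ≠ ∞) :
    MemLp (fun x => Real.exp (t * x)) p (gaussianReal 0 1) := by
  rcases eq_or_ne p 0 with rfl | hp0
  · exact memLp_zero_iff_aestronglyMeasurable.2 (by fun_prop)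
  rw [← integrable_norm_rpow_iff (by fun_prop) hp0 hp]
  refine (integrable_exp_mul_gaussianReal (μ := 0) (v := 1) (p.toReal * t)).congr
    (ae_of_all _ fun x => ?_)
  simp only [Real.norm_eq_abs, Real.abs_exp]
  rw [← Real.exp_mul]
  ring_nf

end Moments

/-! ### Wick polynomials, trigonometric polynomials and density -/

section Wick

variable {Ω κ : Type*} {mΩ : MeasurableSpace Ω} {P : Measure Ω} [IsProbabilityMeasure P]
  {ξ : κ → Ω → ℝ}

theorem mem_momentAlgebra_of_map_eq {X : Ω → ℝ} (hX : AEMeasurable X P)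
    (hlaw : P.map X = gaussianReal 0 1) : X ∈ momentAlgebra P := by
  refine comp_mem_momentAlgebra hX measurable_id fun p hp => ?_
  rw [hlaw]
  exact memLp_id_gaussianReal' p hp

theorem hermiteFun_comp_mem {A : Subalgebra ℝ (Ω → ℝ)} {X : Ω → ℝ} (hX : X ∈ A) (n : ℕ) :
    (fun ω => hermiteFun n (X ω)) ∈ A := by
  simp only [hermiteFun_eq_eval]
  exact eval_comp_mem hX _

theorem wickPolynomial_mem {A : Subalgebra ℝ (Ω → ℝ)} (hξ : ∀ k, ξ k ∈ A) (α : κ →₀ ℕ) :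
    wickPolynomial ξ α ∈ A := by
  have h : wickPolynomial ξ α = (1 / Real.sqrt (multiFactorial α : ℝ)) •
      ∏ k ∈ α.support, fun ω => hermiteFun (α k) (ξ k ω) := by
    ext ω
    simp [wickPolynomial, Finsupp.prod]
  rw [h]
  exact A.smul_mem (A.prod_mem fun k _ => hermiteFun_comp_mem (hξ k) _) _

theorem multiFactorial_pos (α : κ →₀ ℕ) : 0 < multiFactorial α :=
  Finset.prod_pos fun _ _ => Nat.factorial_pos _

/-- The Wick polynomials of independent standard Gaussian variables are orthonormal. -/
theorem integral_wickPolynomial_mul {P : Measure Ω} (hm : ∀ k, AEMeasurable (ξ k) P) (hind : iIndepFun ξ P)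
    (hlaw : ∀ k, P.map (ξ k) = gaussianReal 0 1) (α β : κ →₀ ℕ) [Decidable (α = β)] :
    ∫ ω, wickPolynomial ξ α ω * wickPolynomial ξ β ω ∂P = if α = β then 1 else 0 := by
  classical
  -- Since `h_0 = 1`, both products can be taken over this common finite index set, so that
  -- independence applies factor by factor.
  let F := α.support ∪ β.support
  have hW : ∀ γ : κ →₀ ℕ, γ.support ⊆ F → ∀ ω, wickPolynomial ξ γ ω
      = (1 / Real.sqrt (multiFactorial γ : ℝ)) * ∏ k : F, hermiteFun (γ k) (ξ k ω) := by
    intro γ hγ ω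
    rw [wickPolynomial, Finsupp.prod_of_support_subset γ hγ _ (fun _ _ => hermiteFun_zero _),
      ← Finset.prod_coe_sort F]
  have h1 : ∀ ω, wickPolynomial ξ α ω * wickPolynomial ξ β ω
      = (1 / Real.sqrt (multiFactorial α : ℝ)) * (1 / Real.sqrt (multiFactorial β : ℝ)) *
        ∏ k : F, (hermiteFun (α k) (ξ k ω) * hermiteFun (β k) (ξ k ω)) := by
    intro ω
    rw [hW α Finset.subset_union_left, hW β Finset.subset_union_right, Finset.prod_mul_distrib]
    ring
  have h2 : ∫ ω, ∏ k : F, (hermiteFun (α k) (ξ k ω) * hermiteFun (β k) (ξ k ω)) ∂P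
      = ∏ k : F, if α k = β k then ((α k).factorial : ℝ) else 0 := by
    have hmm : ∀ k : F, Measurable fun x => hermiteFun (α k) x * hermiteFun (β k) x := fun k =>
      (measurable_hermiteFun _).mul (measurable_hermiteFun _)
    have hF : iIndepFun (fun k : F => ξ k) P := hind.precomp Subtype.val_injective
    rw [hF.integral_fun_prod_comp
      (f := fun (k : F) x => hermiteFun (α k) x * hermiteFun (β k) x) (fun k => hm k)
      (fun k => (hmm k).aestronglyMeasurable)]
    refine Finset.prod_congr rfl fun k _ => ?_
    rw [← integral_hermiteFun_mul, ← hlaw k, integral_map (hm k) (hmm k).aestronglyMeasurable]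
  simp only [h1, integral_const_mul, h2]
  split_ifs with h
  · subst h
    have h3 : ∏ k : F, (if α k = α k then ((α k).factorial : ℝ) else 0)
        = (multiFactorial α : ℝ) := by
      rw [multiFactorial, Finsupp.prod_of_support_subset α Finset.subset_union_left _
        (fun _ _ => Nat.factorial_zero), ← Finset.prod_coe_sort F]
      simp
    rw [h3, one_div_mul_one_div, Real.mul_self_sqrt (Nat.cast_nonneg _)]
    have := multiFactorial_pos α
    field_simp
  · obtain ⟨k, hk⟩ : ∃ k, α k ≠ β k := by
      by_contra! h'
      exact h (Finsupp.ext h')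
    have hkF : k ∈ F := by
      simp only [F, Finset.mem_union, Finsupp.mem_support_iff]
      omega
    rw [Finset.prod_eq_zero (Finset.mem_univ (⟨k, hkF⟩ : F)) (if_neg hk), mul_zero]

/-- The span of the Wick polynomials, as functions. -/
def wickSpan (ξ : κ → Ω → ℝ) : Submodule ℝ (Ω → ℝ) :=
  Submodule.span ℝ (Set.range (wickPolynomial ξ))

theorem hermiteProd_mem_wickSpan (α : κ →₀ ℕ) :
    (fun ω => α.prod fun k n => hermiteFun n (ξ k ω)) ∈ wickSpan ξ := by
  have h : (fun ω => α.prod fun k n => hermiteFun n (ξ k ω))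
      = Real.sqrt (multiFactorial α : ℝ) • wickPolynomial ξ α := by
    ext ω
    have h0 : Real.sqrt (multiFactorial α : ℝ) ≠ 0 :=
      (Real.sqrt_pos.2 (Nat.cast_pos.2 (multiFactorial_pos α))).ne'
    simp only [Pi.smul_apply, smul_eq_mul, wickPolynomial]
    field_simp
  rw [h]
  exact (wickSpan ξ).smul_mem _ (Submodule.subset_span ⟨α, rfl⟩)

theorem one_mem_wickSpan : (1 : Ω → ℝ) ∈ wickSpan ξ := by
  simpa using! hermiteProd_mem_wickSpan (ξ := ξ) 0

/-- The Hermite recurrence in coordinate `k` moves `α k` up or down by one and leaves the other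
factors alone. If `α k = 0`, the downward term has coefficient zero. -/
theorem mul_wickPolynomial_mem_wickSpan (k : κ) (α : κ →₀ ℕ) :
    ξ k * wickPolynomial ξ α ∈ wickSpan ξ := by
  classical
  have hu : ∀ n ω, (α.update k n).prod (fun k n => hermiteFun n (ξ k ω))
      = hermiteFun n (ξ k ω) * (α.erase k).prod (fun k n => hermiteFun n (ξ k ω)) := by
    intro n ω
    rw [← Finsupp.mul_prod_erase' (α.update k n) k (fun k n => hermiteFun n (ξ k ω))
      (fun _ => hermiteFun_zero _)]
    have : (α.update k n).erase k = α.erase k := by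
      ext j; by_cases hj : j = k <;> simp [hj, Finsupp.erase, Finsupp.update_apply]
    rw [this]
    simp
  have h : ξ k * wickPolynomial ξ α = (1 / Real.sqrt (multiFactorial α : ℝ)) •
      ((fun ω => (α.update k (α k + 1)).prod fun k n => hermiteFun n (ξ k ω))
        + (α k : ℝ) • fun ω => (α.update k (α k - 1)).prod fun k n => hermiteFun n (ξ k ω)) := by
    ext ω
    simp only [Pi.mul_apply, Pi.smul_apply, Pi.add_apply, smul_eq_mul, hu, wickPolynomial]
    rw [← Finsupp.mul_prod_erase' α k (fun k n => hermiteFun n (ξ k ω))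
      (fun _ => hermiteFun_zero _)]
    linear_combination (1 / Real.sqrt (multiFactorial α : ℝ)) *
      (α.erase k).prod (fun k n => hermiteFun n (ξ k ω)) * hermiteFun_mul_id (α k) (ξ k ω)
  rw [h]
  exact (wickSpan ξ).smul_mem _ ((wickSpan ξ).add_mem (hermiteProd_mem_wickSpan _)
    ((wickSpan ξ).smul_mem _ (hermiteProd_mem_wickSpan _)))

theorem mul_mem_wickSpan {u f : Ω → ℝ} (hu : u ∈ Submodule.span ℝ (Set.range ξ))
    (hf : f ∈ wickSpan ξ) : u * f ∈ wickSpan ξ := by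
  induction hu using Submodule.span_induction with
  | mem u hu =>
    obtain ⟨k, rfl⟩ := hu
    induction hf using Submodule.span_induction with
    | mem f hf =>
      obtain ⟨α, rfl⟩ := hf
      exact mul_wickPolynomial_mem_wickSpan k α
    | zero => rw [mul_zero]; exact zero_mem _
    | add f g _ _ hf hg => rw [mul_add]; exact add_mem hf hg
    | smul c f _ hf => rw [mul_smul_comm]; exact Submodule.smul_mem _ c hf
  | zero => rw [zero_mul]; exact zero_mem _
  | add u v _ _ hu hv => rw [add_mul]; exact add_mem hu hv
  | smul c u _ hu => rw [smul_mul_assoc]; exact Submodule.smul_mem _ c hu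

theorem pow_mem_wickSpan {u : Ω → ℝ} (hu : u ∈ Submodule.span ℝ (Set.range ξ)) (n : ℕ) :
    u ^ n ∈ wickSpan ξ := by
  induction n with
  | zero => rw [pow_zero]; exact one_mem_wickSpan
  | succ n ih => rw [pow_succ']; exact mul_mem_wickSpan hu ih

/-- The exponential of a sum is a product, and Hölder closes the moment algebra under products, so
only the marginal laws matter and not independence. The parameter `t` varies in the induction to
absorb scalars. -/
theorem exp_mul_mem_momentAlgebra (hm : ∀ k, AEMeasurable (ξ k) P)
    (hlaw : ∀ k, P.map (ξ k) = gaussianReal 0 1) {u : Ω → ℝ}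
    (hu : u ∈ Submodule.span ℝ (Set.range ξ)) (t : ℝ) :
    (fun ω => Real.exp (t * u ω)) ∈ momentAlgebra P := by
  induction hu using Submodule.span_induction generalizing t with
  | mem u hu =>
    obtain ⟨k, rfl⟩ := hu
    refine comp_mem_momentAlgebra (φ := fun x => Real.exp (t * x)) (hm k) (by fun_prop) fun p hp => ?_
    rw [hlaw]
    exact memLp_exp_mul_gaussianReal t hp
  | zero =>
    have : (fun ω => Real.exp (t * (0 : Ω → ℝ) ω)) = 1 := by ext ω; simp
    rw [this]
    exact one_mem _
  | add u v _ _ hu hv =>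
    have : (fun ω => Real.exp (t * (u + v) ω))
        = (fun ω => Real.exp (t * u ω)) * fun ω => Real.exp (t * v ω) := by
      ext ω; simp [mul_add, Real.exp_add]
    rw [this]
    exact mul_mem (hu t) (hv t)
  | smul c u _ hu => simpa [mul_assoc] using hu (t * c)

theorem cosh_mem_momentAlgebra (hm : ∀ k, AEMeasurable (ξ k) P)
    (hlaw : ∀ k, P.map (ξ k) = gaussianReal 0 1) {u : Ω → ℝ}
    (hu : u ∈ Submodule.span ℝ (Set.range ξ)) :
    (fun ω => Real.cosh (u ω)) ∈ momentAlgebra P := by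
  have : (fun ω => Real.cosh (u ω))
      = (1 / 2 : ℝ) • ((fun ω => Real.exp (1 * u ω)) + fun ω => Real.exp (-1 * u ω)) := by
    ext ω; simp [Real.cosh_eq]; ring
  rw [this]
  exact (momentAlgebra P).smul_mem (add_mem (exp_mul_mem_momentAlgebra hm hlaw hu 1)
    (exp_mul_mem_momentAlgebra hm hlaw hu (-1))) _

variable {p : ℝ≥0∞} {V : Submodule ℝ (Lp ℝ p P)}

/-- The absolute values of the cosine Taylor terms are the terms of the `cosh` series, giving one
`L^p` majorant for all partial sums. -/
theorem cos_mem_of_mem_span [Fact (1 ≤ p)] (hp : p ≠ ∞) (hV : IsClosed (V : Set (Lp ℝ p P)))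
    (hm : ∀ k, AEMeasurable (ξ k) P) (hlaw : ∀ k, P.map (ξ k) = gaussianReal 0 1)
    (hξV : wickSpan ξ ≤ aeSubmodule V) {u : Ω → ℝ} (hu : u ∈ Submodule.span ℝ (Set.range ξ)) :
    (fun ω => Real.cos (u ω)) ∈ aeSubmodule V := by
  refine mem_aeSubmodule_of_dominated hp hV
    (F := fun n => ∑ i ∈ Finset.range n, ((-1) ^ i / ((2 * i).factorial : ℝ)) • u ^ (2 * i))
    (fun n => hξV (sum_mem fun i _ => Submodule.smul_mem _ _ (pow_mem_wickSpan hu _)))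
    (cosh_mem_momentAlgebra hm hlaw hu p hp) (fun n => ae_of_all _ fun ω => ?_)
    (ae_of_all _ fun ω => ?_)
  · simp only [Finset.sum_apply, Pi.smul_apply, Pi.pow_apply, smul_eq_mul]
    refine (Finset.abs_sum_le_sum_abs _ _).trans ?_
    refine le_trans (Finset.sum_le_sum fun i _ => le_of_eq ?_)
      (sum_le_hasSum (Finset.range n) (fun i _ => ?_) (Real.hasSum_cosh (u ω)))
    · rw [abs_mul, abs_div, abs_pow, abs_neg, abs_one, one_pow, Nat.abs_cast, pow_mul,
        abs_of_nonneg (pow_nonneg (sq_nonneg (u ω)) i)]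
      ring
    · rw [pow_mul]; positivity
  · have h := (Real.hasSum_cos (u ω)).tendsto_sum_nat
    refine h.congr fun n => ?_
    simp only [Finset.sum_apply, Pi.smul_apply, Pi.pow_apply, smul_eq_mul]
    exact Finset.sum_congr rfl fun i _ => by ring

theorem sin_mem_of_mem_span [Fact (1 ≤ p)] (hp : p ≠ ∞) (hV : IsClosed (V : Set (Lp ℝ p P)))
    (hm : ∀ k, AEMeasurable (ξ k) P) (hlaw : ∀ k, P.map (ξ k) = gaussianReal 0 1)
    (hξV : wickSpan ξ ≤ aeSubmodule V) {u : Ω → ℝ} (hu : u ∈ Submodule.span ℝ (Set.range ξ)) :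
    (fun ω => Real.sin (u ω)) ∈ aeSubmodule V := by
  refine mem_aeSubmodule_of_dominated hp hV
    (F := fun n => ∑ i ∈ Finset.range n, ((-1) ^ i / ((2 * i + 1).factorial : ℝ)) • u ^ (2 * i + 1))
    (fun n => hξV (sum_mem fun i _ => Submodule.smul_mem _ _ (pow_mem_wickSpan hu _)))
    (cosh_mem_momentAlgebra hm hlaw hu p hp) (fun n => ae_of_all _ fun ω => ?_)
    (ae_of_all _ fun ω => ?_)
  · simp only [Finset.sum_apply, Pi.smul_apply, Pi.pow_apply, smul_eq_mul]
    refine (Finset.abs_sum_le_sum_abs _ _).trans ?_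
    refine le_trans (Finset.sum_le_sum fun i _ => le_of_eq ?_)
      ((sum_le_hasSum (Finset.range n) (fun i _ => ?_) (Real.hasSum_sinh |u ω|)).trans ?_)
    · rw [abs_mul, abs_div, abs_pow, abs_neg, abs_one, one_pow, Nat.abs_cast, abs_pow]
      ring
    · positivity
    -- The natural majorant is `sinh |u|`, and it lies below `cosh |u| = cosh u`.
    · rw [← Real.cosh_abs (u ω)]
      exact (Real.sinh_lt_cosh _).le
  · have h := (Real.hasSum_sin (u ω)).tendsto_sum_nat
    refine h.congr fun n => ?_
    simp only [Finset.sum_apply, Pi.smul_apply, Pi.pow_apply, smul_eq_mul]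
    exact Finset.sum_congr rfl fun i _ => by ring

/-- The closed subspace of `L²` generated by the family `ξ`. -/
noncomputable def gaussianSpace (P : Measure Ω) [IsProbabilityMeasure P] (ξ : κ → Ω → ℝ) :
    Submodule ℝ (Lp ℝ 2 P) :=
  (Submodule.span ℝ {v : Lp ℝ 2 P | ∃ k, v =ᵐ[P] ξ k}).topologicalClosure

theorem exists_mem_span_ae_eq {P : Measure Ω} {x : Lp ℝ 2 P}
    (hx : x ∈ Submodule.span ℝ {v : Lp ℝ 2 P | ∃ k, v =ᵐ[P] ξ k}) :
    ∃ f ∈ Submodule.span ℝ (Set.range ξ), x =ᵐ[P] f := by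
  induction hx using Submodule.span_induction with
  | mem x hx =>
    obtain ⟨k, hk⟩ := hx
    exact ⟨ξ k, Submodule.subset_span ⟨k, rfl⟩, hk⟩
  | zero => exact ⟨0, zero_mem _, Lp.coeFn_zero _ _ _⟩
  | add x y _ _ hx hy =>
    obtain ⟨f, hf, hxf⟩ := hx
    obtain ⟨g, hg, hyg⟩ := hy
    exact ⟨f + g, add_mem hf hg, (Lp.coeFn_add x y).trans (hxf.add hyg)⟩
  | smul c x _ hx =>
    obtain ⟨f, hf, hxf⟩ := hx
    exact ⟨c • f, Submodule.smul_mem _ c hf, (Lp.coeFn_smul c x).trans (hxf.const_smul c)⟩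

/-- `L²` convergence gives an a.e. convergent subsequence. Only a.e. convergence is kept, which lets
the `L²` closure be used inside `L^p` for every `p`. -/
theorem exists_seq_of_mem_gaussianSpace {u : Ω → ℝ} (hu : u ∈ aeSubmodule (gaussianSpace P ξ)) :
    ∃ F : ℕ → Ω → ℝ, (∀ n, F n ∈ Submodule.span ℝ (Set.range ξ)) ∧
      ∀ᵐ ω ∂P, Tendsto (fun n => F n ω) atTop (𝓝 (u ω)) := by
  obtain ⟨v, hv, hvu⟩ := hu
  obtain ⟨w, hw, hwv⟩ := mem_closure_iff_seq_limit.1 hv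
  choose F hF hwF using fun n => exists_mem_span_ae_eq (hw n)
  have hmeas := tendstoInMeasure_of_tendsto_eLpNorm two_ne_zero
    (fun n => (Lp.aestronglyMeasurable (w n))) (Lp.aestronglyMeasurable v)
    ((Lp.tendsto_Lp_iff_tendsto_eLpNorm' w v).1 hwv)
  obtain ⟨ns, -, hns⟩ := hmeas.exists_seq_tendsto_ae
  refine ⟨fun n => F (ns n), fun n => hF _, ?_⟩
  filter_upwards [hns, hvu, ae_all_iff.2 fun n => hwF n] with ω h1 h2 h3
  rw [← h2]
  exact h1.congr fun n => h3 _

theorem cos_sin_mem_of_mem_gaussianSpace [Fact (1 ≤ p)] (hp : p ≠ ∞)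
    (hV : IsClosed (V : Set (Lp ℝ p P)))
    (hm : ∀ k, AEMeasurable (ξ k) P) (hlaw : ∀ k, P.map (ξ k) = gaussianReal 0 1)
    (hξV : wickSpan ξ ≤ aeSubmodule V) {u : Ω → ℝ} (hu : u ∈ aeSubmodule (gaussianSpace P ξ)) :
    (fun ω => Real.cos (u ω)) ∈ aeSubmodule V ∧ (fun ω => Real.sin (u ω)) ∈ aeSubmodule V := by
  obtain ⟨F, hF, hlim⟩ := exists_seq_of_mem_gaussianSpace hu
  constructor
  · refine mem_aeSubmodule_of_dominated hp hV
      (fun n => cos_mem_of_mem_span hp hV hm hlaw hξV (hF n)) (memLp_const 1)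
      (fun n => ae_of_all _ fun ω => Real.abs_cos_le_one _) ?_
    filter_upwards [hlim] with ω h using (Real.continuous_cos.tendsto _).comp h
  · refine mem_aeSubmodule_of_dominated hp hV
      (fun n => sin_mem_of_mem_span hp hV hm hlaw hξV (hF n)) (memLp_const 1)
      (fun n => ae_of_all _ fun ω => Real.abs_sin_le_one _) ?_
    filter_upwards [hlim] with ω h using (Real.continuous_sin.tendsto _).comp h

/-- The span of `cos u` and `sin u`, for `u` in a space `U` of functions. -/
def trigSpan (U : Submodule ℝ (Ω → ℝ)) : Submodule ℝ (Ω → ℝ) :=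
  Submodule.span ℝ {f | ∃ u ∈ U, f = (fun ω => Real.cos (u ω)) ∨ f = fun ω => Real.sin (u ω)}

theorem cos_mem_trigSpan {U : Submodule ℝ (Ω → ℝ)} {u : Ω → ℝ} (hu : u ∈ U) :
    (fun ω => Real.cos (u ω)) ∈ trigSpan U := Submodule.subset_span ⟨u, hu, Or.inl rfl⟩

theorem sin_mem_trigSpan {U : Submodule ℝ (Ω → ℝ)} {u : Ω → ℝ} (hu : u ∈ U) :
    (fun ω => Real.sin (u ω)) ∈ trigSpan U := Submodule.subset_span ⟨u, hu, Or.inr rfl⟩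

/-- Product-to-sum formulas; they need `u + v` and `u - v` in `U`, which is why `U` is a linear
space. -/
theorem mul_mem_trigSpan {U : Submodule ℝ (Ω → ℝ)} {f g : Ω → ℝ} (hf : f ∈ trigSpan U)
    (hg : g ∈ trigSpan U) : f * g ∈ trigSpan U := by
  induction hf using Submodule.span_induction with
  | zero => rw [zero_mul]; exact zero_mem _
  | add u v _ _ hu hv => rw [add_mul]; exact add_mem hu hv
  | smul c u _ hu => rw [smul_mul_assoc]; exact Submodule.smul_mem _ c hu
  | mem f hf =>
    induction hg using Submodule.span_induction with
    | zero => rw [mul_zero]; exact zero_mem _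
    | add f g _ _ hf hg => rw [mul_add]; exact add_mem hf hg
    | smul c f _ hf => rw [mul_smul_comm]; exact Submodule.smul_mem _ c hf
    | mem g hg =>
      obtain ⟨u, hu, hf⟩ := hf
      obtain ⟨v, hv, hg⟩ := hg
      have hcp := cos_mem_trigSpan (U.add_mem hu hv)
      have hcm := cos_mem_trigSpan (U.sub_mem hu hv)
      have hsp := sin_mem_trigSpan (U.add_mem hu hv)
      have hsm := sin_mem_trigSpan (U.sub_mem hu hv)
      rcases hf with rfl | rfl <;> rcases hg with rfl | rfl
      · convert! Submodule.smul_mem _ (1 / 2 : ℝ) (add_mem hcp hcm) using 1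
        ext ω
        simp [Real.cos_add, Real.cos_sub]; ring
      · convert! Submodule.smul_mem _ (1 / 2 : ℝ) (sub_mem hsp hsm) using 1
        ext ω
        simp [Real.sin_add, Real.sin_sub]; ring
      · convert! Submodule.smul_mem _ (1 / 2 : ℝ) (add_mem hsp hsm) using 1
        ext ω
        simp [Real.sin_add, Real.sin_sub]; ring
      · convert! Submodule.smul_mem _ (1 / 2 : ℝ) (sub_mem hcm hcp) using 1
        ext ω
        simp [Real.cos_add, Real.cos_sub]; ring

/-- The trigonometric polynomials in the elements of `U`. -/
def trigAlgebra (U : Submodule ℝ (Ω → ℝ)) : Subalgebra ℝ (Ω → ℝ) :=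
  (trigSpan U).toSubalgebra (by simpa using! cos_mem_trigSpan U.zero_mem)
    fun _ _ => mul_mem_trigSpan

theorem measurable_of_mem_trigSpan {U : Submodule ℝ (Ω → ℝ)} (hU : ∀ u ∈ U, Measurable u)
    {f : Ω → ℝ} (hf : f ∈ trigSpan U) : Measurable f := by
  induction hf using Submodule.span_induction with
  | zero => exact measurable_zero
  | add u v _ _ hu hv => exact hu.add hv
  | smul c u _ hu => exact hu.const_smul c
  | mem f hf =>
    obtain ⟨u, hu, rfl | rfl⟩ := hf
    · exact (hU u hu).cos
    · exact (hU u hu).sin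

theorem bounded_of_mem_trigSpan {U : Submodule ℝ (Ω → ℝ)} {f : Ω → ℝ} (hf : f ∈ trigSpan U) :
    ∃ M, ∀ ω, |f ω| ≤ M := by
  induction hf using Submodule.span_induction with
  | zero => exact ⟨0, by simp⟩
  | add u v _ _ hu hv =>
    obtain ⟨M, hM⟩ := hu
    obtain ⟨N, hN⟩ := hv
    exact ⟨M + N, fun ω => (abs_add_le _ _).trans (add_le_add (hM ω) (hN ω))⟩
  | smul c u _ hu =>
    obtain ⟨M, hM⟩ := hu
    refine ⟨|c| * M, fun ω => ?_⟩
    rw [Pi.smul_apply, smul_eq_mul, abs_mul]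
    exact mul_le_mul_of_nonneg_left (hM ω) (abs_nonneg c)
  | mem f hf =>
    obtain ⟨u, hu, rfl | rfl⟩ := hf
    · exact ⟨1, fun ω => Real.abs_cos_le_one _⟩
    · exact ⟨1, fun ω => Real.abs_sin_le_one _⟩

/-- The unbounded `u` is recovered from bounded functions as the pointwise limit of `(n + 1) sin (u
/ (n + 1))`, the difference quotient of `x ↦ sin (x u)` at `0`. -/
theorem comap_le_trigAlgebra {U : Submodule ℝ (Ω → ℝ)} {u : Ω → ℝ} (hu : u ∈ U) :
    MeasurableSpace.comap u inferInstance
      ≤ ⨆ f ∈ trigAlgebra U, MeasurableSpace.comap f (inferInstance : MeasurableSpace ℝ) := by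
  rw [← measurable_iff_comap_le]
  let _ : MeasurableSpace Ω :=
    ⨆ f ∈ trigAlgebra U, MeasurableSpace.comap f (inferInstance : MeasurableSpace ℝ)
  have hs : ∀ n : ℕ, Measurable fun ω => ((n : ℝ) + 1) * Real.sin ((1 / ((n : ℝ) + 1)) * u ω) := by
    intro n
    refine Measurable.const_mul ?_ _
    rw [measurable_iff_comap_le]
    exact le_iSup₂_of_le _ (sin_mem_trigSpan (U.smul_mem (1 / ((n : ℝ) + 1)) hu)) le_rfl
  refine measurable_of_tendsto_metrizable hs (tendsto_pi_nhds.2 fun ω => ?_)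
  have h1 : HasDerivAt (fun x : ℝ => Real.sin (x * u ω)) (u ω) 0 := by
    have := ((hasDerivAt_id (0 : ℝ)).mul_const (u ω)).sin
    simpa using! this
  have h2 := h1.tendsto_slope_zero_right.comp
    (tendsto_nhdsWithin_iff.2 ⟨tendsto_one_div_add_atTop_nhds_zero_nat (𝕜 := ℝ),
      Eventually.of_forall fun n => by
        change (0 : ℝ) < 1 / ((n : ℝ) + 1)
        positivity⟩)
  refine h2.congr fun n => ?_
  simp

/-- If `m` is generated by elements of the closed Gaussian space of `ξ`, then a closed subspace of
`L^p` that contains the Wick polynomials contains all `m`-measurable functions. -/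
theorem lpMeas_le_of_wickSpan_le {Ω κ : Type*} {m mΩ : MeasurableSpace Ω} {P : Measure Ω}
    [IsProbabilityMeasure P] {ξ : κ → Ω → ℝ} {p : ℝ≥0∞} {V : Submodule ℝ (Lp ℝ p P)}
    [Fact (1 ≤ p)] (hp : p ≠ ∞)
    (hV : IsClosed (V : Set (Lp ℝ p P)))
    (hm : ∀ k, AEMeasurable (ξ k) P) (hlaw : ∀ k, P.map (ξ k) = gaussianReal 0 1)
    (hξV : wickSpan ξ ≤ aeSubmodule V)
    (hgen : m ≤ ⨆ (u : Ω → ℝ) (_ : Measurable u ∧ u ∈ aeSubmodule (gaussianSpace P ξ)),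
      MeasurableSpace.comap u inferInstance) :
    lpMeas ℝ ℝ m p P ≤ V := by
  let U : Submodule ℝ (Ω → ℝ) :=
    { carrier := {u | Measurable u ∧ u ∈ aeSubmodule (gaussianSpace P ξ)}
      zero_mem' := ⟨measurable_zero, zero_mem _⟩
      add_mem' := fun h1 h2 => ⟨h1.1.add h2.1, add_mem h1.2 h2.2⟩
      smul_mem' := fun c _ h => ⟨h.1.const_smul c, Submodule.smul_mem _ c h.2⟩ }
  refine lpMeas_le_of_subalgebra hp hV (trigAlgebra U)
    (fun f hf => measurable_of_mem_trigSpan (U := U) (fun u hu => hu.1) hf)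
    (fun f hf => bounded_of_mem_trigSpan hf) (fun f hf => ?_)
    (hgen.trans (iSup₂_le fun u hu => comap_le_trigAlgebra (U := U) hu))
  have hle : trigSpan U ≤ aeSubmodule V := by
    refine Submodule.span_le.2 ?_
    rintro f ⟨u, hu, rfl | rfl⟩
    · exact (cos_sin_mem_of_mem_gaussianSpace hp hV hm hlaw hξV hu.2).1
    · exact (cos_sin_mem_of_mem_gaussianSpace hp hV hm hlaw hξV hu.2).2
  exact hle hf

end Wick

/-! ### Laws and independence in a Gaussian space -/

section GaussianSpace

variable {Ω κ : Type*} {mΩ : MeasurableSpace Ω} {P : Measure Ω} [IsProbabilityMeasure P]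
  {X : κ → Ω → ℝ}

theorem gaussianSpace_isClosed : IsClosed (gaussianSpace P X : Set (Lp ℝ 2 P)) :=
  Submodule.isClosed_topologicalClosure _

theorem mem_gaussianSpace (hX : ∀ k, MemLp (X k) 2 P) (k : κ) :
    X k ∈ aeSubmodule (gaussianSpace P X) :=
  mem_aeSubmodule_of_toLp_mem (hX k) (Submodule.le_topologicalClosure _
    (Submodule.subset_span ⟨k, (hX k).coeFn_toLp⟩))

theorem norm_sq_eq_integral {P : Measure Ω} {u : Ω → ℝ} {v : Lp ℝ 2 P} (h : v =ᵐ[P] u) :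
    ‖v‖ ^ 2 = ∫ ω, u ω ^ 2 ∂P := by
  rw [← real_inner_self_eq_norm_sq, L2.inner_def]
  refine integral_congr_ae ?_
  filter_upwards [h] with ω hω
  simp [hω, sq]

theorem inner_eq_integral_mul {P : Measure Ω} {f g : Ω → ℝ} {v w : Lp ℝ 2 P} (hv : v =ᵐ[P] f) (hw : w =ᵐ[P] g) :
    inner ℝ v w = ∫ ω, f ω * g ω ∂P := by
  rw [L2.inner_def]
  refine integral_congr_ae ?_
  filter_upwards [hv, hw] with ω h1 h2
  simp [h1, h2, mul_comm]

/-- The linear combinations of a centered Gaussian process are centered Gaussian. -/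
theorem map_eq_of_mem_span {P : Measure Ω} (hX : IsGaussianProcess X P) (hmean : ∀ k, ∫ ω, X k ω ∂P = 0)
    {u : Ω → ℝ} (hu : u ∈ Submodule.span ℝ (Set.range X)) :
    AEMeasurable u P ∧ P.map u = gaussianReal 0 (∫ ω, u ω ^ 2 ∂P).toNNReal := by
  obtain ⟨c, rfl⟩ := (Finsupp.mem_span_range_iff_exists_finsupp).1 hu
  have hL : HasGaussianLaw (c.sum fun i a => a • X i) P :=
    (hX.smul c).hasGaussianLaw_sum (I := c.support)
  have hint : ∀ k, Integrable (X k) P := fun k =>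
    memLp_one_iff_integrable.1 ((hX.hasGaussianLaw_eval k).memLp ENNReal.one_ne_top)
  have h0 : ∫ ω, (c.sum fun i a => a • X i) ω ∂P = 0 := by
    simp only [Finsupp.sum, Finset.sum_apply, Pi.smul_apply, smul_eq_mul]
    rw [integral_finsetSum _ fun i _ => (hint i).const_mul _]
    simp [integral_const_mul, hmean]
  refine ⟨hL.aemeasurable, ?_⟩
  rw [hL.map_eq_gaussianReal, variance_of_integral_eq_zero hL.aemeasurable h0, h0]

theorem integral_cexp_of_map_eq {P : Measure Ω} {u : Ω → ℝ} (hu : AEMeasurable u P) {v : NNReal}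
    (h : P.map u = gaussianReal 0 v) :
    ∫ ω, Complex.exp (u ω * Complex.I) ∂P = Complex.exp (-v / 2) := by
  have h1 := charFun_gaussianReal (μ := 0) (v := v) 1
  rw [← h, charFun_apply_real, integral_map hu (by fun_prop)] at h1
  simp only [Complex.ofReal_one, one_mul] at h1
  rw [h1]
  congr 1
  simp
  ring

/-- The elements of the closed span of a centered Gaussian process are centered Gaussian. -/
theorem integral_cexp_of_mem_gaussianSpace (hX : IsGaussianProcess X P)
    (hmean : ∀ k, ∫ ω, X k ω ∂P = 0) {v : Lp ℝ 2 P} (hv : v ∈ gaussianSpace P X) :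
    ∫ ω, Complex.exp (v ω * Complex.I) ∂P = Complex.exp (-(‖v‖ : ℂ) ^ 2 / 2) := by
  let N : Set (Lp ℝ 2 P) :=
    {v | ∫ ω, Complex.exp (v ω * Complex.I) ∂P = Complex.exp (-(‖v‖ : ℂ) ^ 2 / 2)}
  -- Along a subsequence converging a.e., the left side converges by dominated convergence and the
  -- right side by continuity of the norm.
  have hN : IsClosed N := by
    refine IsSeqClosed.isClosed fun w x hw hwx => ?_
    obtain ⟨ns, hns, hlim⟩ := (tendstoInMeasure_of_tendsto_eLpNorm two_ne_zero
      (fun n => (Lp.aestronglyMeasurable (w n))) (Lp.aestronglyMeasurable x)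
      ((Lp.tendsto_Lp_iff_tendsto_eLpNorm' w x).1 hwx)).exists_seq_tendsto_ae
    have h1 : Tendsto (fun n => ∫ ω, Complex.exp (w (ns n) ω * Complex.I) ∂P) atTop
        (𝓝 (∫ ω, Complex.exp (x ω * Complex.I) ∂P)) := by
      refine tendsto_integral_of_dominated_convergence (fun _ => 1) (fun n => ?_)
        (integrable_const _) (fun n => ae_of_all _ fun ω => ?_) ?_
      · have := Lp.aestronglyMeasurable (w (ns n))
        exact Complex.continuous_exp.comp_aestronglyMeasurable
          ((Complex.continuous_ofReal.comp_aestronglyMeasurable this).mul_const _)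
      · rw [Complex.norm_exp_ofReal_mul_I]
      · filter_upwards [hlim] with ω hω
        exact (Complex.continuous_exp.tendsto _).comp
          (((Complex.continuous_ofReal.tendsto _).comp hω).mul_const _)
    have h2 : Tendsto (fun n => Complex.exp (-(‖w (ns n)‖ : ℂ) ^ 2 / 2)) atTop
        (𝓝 (Complex.exp (-(‖x‖ : ℂ) ^ 2 / 2))) := by
      have hc : Continuous fun y : Lp ℝ 2 P => Complex.exp (-(‖y‖ : ℂ) ^ 2 / 2) := by fun_prop
      exact (hc.tendsto x).comp (hwx.comp hns.tendsto_atTop)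
    refine tendsto_nhds_unique h1 (h2.congr fun n => ?_)
    exact (hw (ns n)).symm
  refine closure_minimal (s := (Submodule.span ℝ {v : Lp ℝ 2 P | ∃ k, v =ᵐ[P] X k} : Set _))
    (t := N) (fun x hx => ?_) hN
    (by simpa only [gaussianSpace, ← SetLike.mem_coe, Submodule.topologicalClosure_coe] using hv)
  obtain ⟨f, hf, hxf⟩ := exists_mem_span_ae_eq hx
  obtain ⟨hfm, hlaw⟩ := map_eq_of_mem_span hX hmean hf
  have h3 := integral_cexp_of_map_eq hfm hlaw
  have h4 : ∫ ω, Complex.exp (x ω * Complex.I) ∂P = ∫ ω, Complex.exp (f ω * Complex.I) ∂P := by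
    refine integral_congr_ae ?_
    filter_upwards [hxf] with ω hω
    rw [hω]
  change ∫ ω, Complex.exp (x ω * Complex.I) ∂P = Complex.exp (-(‖x‖ : ℂ) ^ 2 / 2)
  rw [h4, h3, ← norm_sq_eq_integral hxf]
  congr 1
  have : (((‖x‖ ^ 2).toNNReal : ℝ) : ℂ) = (‖x‖ : ℂ) ^ 2 := by
    rw [Real.coe_toNNReal _ (sq_nonneg _)]; push_cast; rfl
  rw [← this]

/-- The exponential identity applied to every multiple `t • v` is the characteristic function of `u`
at `t`, which determines the law. -/
theorem map_eq_of_mem_gaussianSpace (hX : IsGaussianProcess X P)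
    (hmean : ∀ k, ∫ ω, X k ω ∂P = 0) {u : Ω → ℝ} (hu : u ∈ aeSubmodule (gaussianSpace P X)) :
    P.map u = gaussianReal 0 (∫ ω, u ω ^ 2 ∂P).toNNReal := by
  obtain ⟨v, hv, hvu⟩ := hu
  have hum : AEMeasurable u P := (Lp.aestronglyMeasurable v).aemeasurable.congr hvu
  have : IsProbabilityMeasure (P.map u) := Measure.isProbabilityMeasure_map hum
  refine Measure.ext_of_charFun (funext fun t => ?_)
  rw [charFun_gaussianReal, charFun_apply_real, integral_map hum (by fun_prop)]
  have h := integral_cexp_of_mem_gaussianSpace hX hmean (Submodule.smul_mem _ t hv)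
  have h1 : ∫ ω, Complex.exp (t * u ω * Complex.I) ∂P
      = ∫ ω, Complex.exp ((t • v : Lp ℝ 2 P) ω * Complex.I) ∂P := by
    refine integral_congr_ae ?_
    filter_upwards [hvu, Lp.coeFn_smul t v] with ω h1 h2
    rw [h2, Pi.smul_apply, h1]
    simp
  rw [h1, h, ← norm_sq_eq_integral hvu, Real.coe_toNNReal _ (sq_nonneg _), norm_smul]
  congr 1
  have h2 : ((‖t‖ * ‖v‖ : ℝ) : ℂ) ^ 2 = ((‖v‖ ^ 2 : ℝ) : ℂ) * (t : ℂ) ^ 2 := by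
    rw [Real.norm_eq_abs, ← Complex.ofReal_pow, mul_pow, sq_abs]
    push_cast
    ring
  rw [h2]
  simp
  ring

/-- Orthonormal elements of a Gaussian space are independent. -/
theorem iIndepFun_of_mem_gaussianSpace {κ' : Type*} {η : κ' → Ω → ℝ} (hX : IsGaussianProcess X P)
    (hmean : ∀ k, ∫ ω, X k ω ∂P = 0) (hη : ∀ k, η k ∈ aeSubmodule (gaussianSpace P X))
    (horth : ∀ j k, j ≠ k → ∫ ω, η j ω * η k ω ∂P = 0) : iIndepFun η P := by
  have hm : ∀ k, AEMeasurable (η k) P := fun k =>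
    (memLp_of_mem_aeSubmodule (hη k)).1.aemeasurable
  have hmean' : ∀ k, ∫ ω, η k ω ∂P = 0 := fun k => by
    have h := map_eq_of_mem_gaussianSpace hX hmean (hη k)
    have h2 := integral_map (hm k) (f := fun x => x) (by fun_prop)
    rw [← h2, h, integral_id_gaussianReal]
  rw [iIndepFun_iff_finset]
  intro I
  -- Cramér–Wold: a linear functional of the finite vector stays in the Gaussian space and so is
  -- Gaussian. For a jointly Gaussian vector, zero covariance yields independence.
  have hG : HasGaussianLaw (fun ω => (fun i : I => η i ω)) P := by
    refine ⟨isGaussian_of_map_eq_gaussianReal fun L => ?_⟩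
    have hmem : (fun ω => L (fun i : I => η i ω)) ∈ aeSubmodule (gaussianSpace P X) := by
      classical
      have : (fun ω => L (fun i : I => η i ω))
          = ∑ i : I, L (Pi.single i 1) • η i := by
        ext ω
        have h1 := L.pi_apply_eq_sum_univ (fun i : I => η i ω)
        refine h1.trans ?_
        rw [Finset.sum_apply]
        refine Finset.sum_congr rfl fun i _ => ?_
        rw [Pi.smul_apply, smul_eq_mul, smul_eq_mul, mul_comm]
        congr 1
        refine congrArg L (funext fun j => ?_)
        simp [Pi.single_apply, eq_comm]
      rw [this]
      exact sum_mem fun i _ => Submodule.smul_mem _ _ (hη i)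
    refine ⟨0, _, (Eq.trans ?_ (map_eq_of_mem_gaussianSpace hX hmean hmem))⟩
    rw [AEMeasurable.map_map_of_aemeasurable (by fun_prop)
      (aemeasurable_pi_lambda (fun ω (i : I) => η i ω) fun i => hm i)]
    rfl
  refine hG.iIndepFun_of_covariance_eq_zero (X := fun i : I => η i) fun i j hij => ?_
  rw [covariance_eq_sub (memLp_of_mem_aeSubmodule (hη i)) (memLp_of_mem_aeSubmodule (hη j)),
    hmean' i, zero_mul, sub_zero]
  exact horth i j fun h => hij (Subtype.ext h)

end GaussianSpace

/-! ### Gaussianity and covariance of the `Q`-Brownian motion -/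

section BrownianMotion

variable {Ω Z : Type*} {mΩ : MeasurableSpace Ω} {P : Measure Ω} [IsProbabilityMeasure P]
  [NormedAddCommGroup Z] [InnerProductSpace ℝ Z] [MeasurableSpace Z] [BorelSpace Z]
  {T : ℝ} {Q : Z →L[ℝ] Z} {W : Set.Icc (0 : ℝ) T → Ω → Z}

theorem IsQBrownianMotion.map_inner_sub (hQ : Q.IsPositive) (hW : IsQBrownianMotion P Q W)
    {s t : Set.Icc (0 : ℝ) T} (hst : s ≤ t) (z : Z) :
    P.map (fun ω => inner ℝ z (W t ω - W s ω))
      = gaussianReal 0 (((t : ℝ) - s) * inner ℝ (Q z) z).toNNReal := by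
  have hm : Measurable fun ω => inner ℝ z (W t ω - W s ω) := by
    have h1 := hW.measurable t
    have h2 := hW.measurable s
    have h3 : Measurable fun ω => inner ℝ z (W t ω) :=
      (continuous_const.inner continuous_id).measurable.comp h1
    have h4 : Measurable fun ω => inner ℝ z (W s ω) :=
      (continuous_const.inner continuous_id).measurable.comp h2
    simpa only [inner_sub_right] using! h3.sub h4
  -- The Gaussian increment axiom only covers `s < t`; for `s = t` the law is the Dirac mass at
  -- zero, the Gaussian of variance zero.
  rcases hst.eq_or_lt with rfl | hlt
  · simp only [sub_self, inner_zero_right, zero_mul, Real.toNNReal_zero, gaussianReal_zero_var]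
    rw [Measure.map_const]
    simp
  have hnn : 0 ≤ ((t : ℝ) - s) * inner ℝ (Q z) z := by
    refine mul_nonneg (sub_nonneg.2 (Subtype.coe_le_coe.2 hst)) ?_
    exact hQ.inner_nonneg_left z
  have : IsProbabilityMeasure (P.map fun ω => inner ℝ z (W t ω - W s ω)) :=
    Measure.isProbabilityMeasure_map hm.aemeasurable
  refine Measure.ext_of_charFun (funext fun a => ?_)
  rw [charFun_gaussianReal, charFun_apply_real, integral_map hm.aemeasurable (by fun_prop),
    Real.coe_toNNReal _ hnn]
  -- The minus sign matches the convention `e^{-i⟨z,·⟩}` with the characteristic function.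
  have h := hW.gaussian s t hlt (-(a • z))
  have h1 : ∀ ω, -(Complex.I * ((inner ℝ (-(a • z)) (W t ω - W s ω) : ℝ) : ℂ))
      = a * ((inner ℝ z (W t ω - W s ω) : ℝ) : ℂ) * Complex.I := fun ω => by
    rw [inner_neg_left, real_inner_smul_left]
    push_cast
    ring
  simp only [h1] at h
  rw [h, Complex.ofReal_exp]
  congr 1
  simp only [smul_apply, map_neg, map_smul, inner_smul_left, inner_smul_right,
    inner_neg_left, inner_neg_right]
  simp
  ring

theorem IsQBrownianMotion.map_inner (hT : 0 ≤ T) (hQ : Q.IsPositive)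
    (hW : IsQBrownianMotion P Q W) (t : Set.Icc (0 : ℝ) T) (z : Z) :
    P.map (fun ω => inner ℝ z (W t ω))
      = gaussianReal 0 ((t : ℝ) * inner ℝ (Q z) z).toNNReal := by
  have h := hW.map_inner_sub hQ (s := ⟨0, Set.left_mem_Icc.2 hT⟩) (t := t) t.2.1 z
  simpa [hW.zero ⟨0, Set.left_mem_Icc.2 hT⟩ rfl] using h

variable [TopologicalSpace.SeparableSpace Z] [CompleteSpace Z]

theorem IsQBrownianMotion.isGaussianProcess (hT : 0 ≤ T) (hQ : Q.IsPositive)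
    (hW : IsQBrownianMotion P Q W) :
    IsGaussianProcess (fun (k : Set.Icc (0 : ℝ) T × Z) ω => inner ℝ k.2 (W k.1 ω)) P := by
  have : SecondCountableTopology Z := UniformSpace.secondCountable_of_separable Z
  let _ : OrderBot (Set.Icc (0 : ℝ) T) :=
    { bot := ⟨0, Set.left_mem_Icc.2 hT⟩, bot_le := fun t => t.2.1 }
  have hbot : ∀ ω, W ⊥ ω = 0 := hW.zero ⊥ rfl
  have hlaw : ∀ t, HasGaussianLaw (W t) P := fun t => by
    refine ⟨isGaussian_of_map_eq_gaussianReal fun L => ?_⟩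
    have h := hW.map_inner_sub hQ (bot_le : ⊥ ≤ t) ((InnerProductSpace.toDual ℝ Z).symm L)
    refine ⟨_, _, Eq.trans ?_ h⟩
    rw [Measure.map_map (by fun_prop) (hW.measurable t)]
    congr 1
    ext ω
    simp [hbot]
  have hG : IsGaussianProcess W P := hW.indep.isGaussianProcess hlaw (ae_of_all _ hbot)
  refine hG.of_isGaussianProcess fun k => ⟨{k.1},
    (innerSL ℝ k.2).comp (ContinuousLinearMap.proj ⟨k.1, by simp⟩), fun ω => ?_⟩
  simp

variable (hT : 0 ≤ T) (hQ : Q.IsPositive) (hW : IsQBrownianMotion P Q W)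
include hT hQ hW

theorem IsQBrownianMotion.memLp_inner (t : Set.Icc (0 : ℝ) T) (z : Z) :
    MemLp (fun ω => inner ℝ z (W t ω)) 2 P :=
  ((hW.isGaussianProcess hT hQ).hasGaussianLaw_eval (t, z)).memLp ENNReal.ofNat_ne_top

theorem IsQBrownianMotion.integral_inner (t : Set.Icc (0 : ℝ) T) (z : Z) :
    ∫ ω, inner ℝ z (W t ω) ∂P = 0 := by
  have h := integral_map (hW.memLp_inner hT hQ t z).1.aemeasurable (f := fun x => x)
    (by fun_prop)
  rw [← h, hW.map_inner hT hQ, integral_id_gaussianReal]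

theorem IsQBrownianMotion.integral_inner_sq (t : Set.Icc (0 : ℝ) T) (z : Z) :
    ∫ ω, (inner ℝ z (W t ω)) ^ 2 ∂P = t * inner ℝ (Q z) z := by
  have hm := (hW.memLp_inner hT hQ t z).1.aemeasurable
  have hv := variance_map (X := fun x : ℝ => x) (by fun_prop) hm
  rw [hW.map_inner hT hQ, variance_fun_id_gaussianReal, Real.coe_toNNReal _
    (mul_nonneg t.2.1 (hQ.inner_nonneg_left z))] at hv
  rw [hv, Function.comp_def, variance_of_integral_eq_zero hm (hW.integral_inner hT hQ t z)]

/-- Polarisation of the second moment formula, using the symmetry of `Q`. -/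
theorem IsQBrownianMotion.integral_inner_mul_self (t : Set.Icc (0 : ℝ) T) (x y : Z) :
    ∫ ω, inner ℝ x (W t ω) * inner ℝ y (W t ω) ∂P = t * inner ℝ (Q x) y := by
  have hsq : ∀ z, Integrable (fun ω => (inner ℝ z (W t ω)) ^ 2) P := fun z =>
    (hW.memLp_inner hT hQ t z).integrable_sq
  have h1 : ∀ ω, inner ℝ x (W t ω) * inner ℝ y (W t ω)
      = (1 / 4) * ((inner ℝ (x + y) (W t ω)) ^ 2 - (inner ℝ (x - y) (W t ω)) ^ 2) := fun ω => by
    rw [inner_add_left, inner_sub_left]; ring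
  simp only [h1]
  rw [integral_const_mul, integral_sub (hsq _) (hsq _), hW.integral_inner_sq hT hQ,
    hW.integral_inner_sq hT hQ]
  have h2 : inner ℝ (Q y) x = inner ℝ (Q x) y := by
    rw [real_inner_comm]
    exact (hQ.isSymmetric x y).symm
  simp only [map_add, map_sub, inner_add_left, inner_add_right, inner_sub_left, inner_sub_right, h2]
  ring

/-- For `s ≤ t`, write `W_t` as `W_s` plus a centered increment independent of `W_s`; only the `W_s`
part contributes. The other order follows from the symmetry of `Q`. -/
theorem IsQBrownianMotion.integral_inner_mul (s t : Set.Icc (0 : ℝ) T) (x y : Z) :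
    ∫ ω, inner ℝ x (W s ω) * inner ℝ y (W t ω) ∂P = min (s : ℝ) t * inner ℝ (Q x) y := by
  have key : ∀ (s t : Set.Icc (0 : ℝ) T), s ≤ t → ∀ x y : Z,
      ∫ ω, inner ℝ x (W s ω) * inner ℝ y (W t ω) ∂P = s * inner ℝ (Q x) y := by
    intro s t hst x y
    have h1 : ∀ ω, inner ℝ x (W s ω) * inner ℝ y (W t ω)
        = inner ℝ x (W s ω) * inner ℝ y (W s ω)
          + inner ℝ x (W s ω) * inner ℝ y (W t ω - W s ω) := fun ω => by
      rw [inner_sub_right]; ring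
    have hx := hW.memLp_inner hT hQ s x
    have hy : MemLp (fun ω => inner ℝ y (W t ω - W s ω)) 2 P := by
      simp only [inner_sub_right]
      exact (hW.memLp_inner hT hQ t y).sub (hW.memLp_inner hT hQ s y)
    have hind : IndepFun (fun ω => inner ℝ x (W s ω)) (fun ω => inner ℝ y (W t ω - W s ω)) P := by
      have h := hW.indep.indepFun_eval_sub (r := ⟨0, Set.left_mem_Icc.2 hT⟩) (s := s) (t := t)
        s.2.1 hst (ae_of_all _ (hW.zero ⟨0, Set.left_mem_Icc.2 hT⟩ rfl))
      exact h.comp (φ := fun z => inner ℝ x z) (ψ := fun z => inner ℝ y z)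
        (continuous_const.inner continuous_id).measurable
        (continuous_const.inner continuous_id).measurable
    simp only [h1]
    rw [integral_add (by exact hx.integrable_mul (hW.memLp_inner hT hQ s y))
      (by exact hx.integrable_mul hy), hW.integral_inner_mul_self hT hQ, hind.integral_fun_mul_eq_mul_integral hx.1 hy.1,
      hW.integral_inner hT hQ, zero_mul, add_zero]
  rcases le_total s t with hst | hst
  · rw [key s t hst, min_eq_left (Subtype.coe_le_coe.2 hst)]
  · have h2 : inner ℝ (Q x) y = inner ℝ (Q y) x := by
      rw [real_inner_comm x]
      exact hQ.isSymmetric x y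
    rw [min_eq_right (Subtype.coe_le_coe.2 hst), h2, ← key t s hst y x]
    simp only [mul_comm]

end BrownianMotion

/-! ### Isometries from equal Gram matrices -/

section Isometry

/-- Two families with the same Gram matrix are related by a linear isometry, if the first one is
total. -/
theorem exists_linearIsometry_of_gram_eq {κ E F : Type*} [NormedAddCommGroup E]
    [InnerProductSpace ℝ E] [NormedAddCommGroup F] [InnerProductSpace ℝ F] [CompleteSpace F]
    (x : κ → E) (y : κ → F) (hgram : ∀ j k, inner ℝ (x j) (x k) = inner ℝ (y j) (y k))
    (hx : (Submodule.span ℝ (Set.range x)).topologicalClosure = ⊤) :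
    ∃ J : E →ₗᵢ[ℝ] F, ∀ k, J (x k) = y k := by
  let e := Finsupp.linearCombination ℝ x
  let f := Finsupp.linearCombination ℝ y
  -- Equal Gram matrices give equal norms of corresponding combinations. This yields
  -- well-definedness on the span, continuity for the extension, and isometry.
  have hinner : ∀ c, ‖f c‖ = ‖e c‖ := fun c => by
    rw [← sq_eq_sq₀ (norm_nonneg _) (norm_nonneg _), ← real_inner_self_eq_norm_sq,
      ← real_inner_self_eq_norm_sq]
    simp only [e, f, Finsupp.linearCombination_apply, Finsupp.sum, sum_inner, inner_sum,
      inner_smul_left, inner_smul_right, hgram]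
  have hdense : DenseRange e := by
    have h1 : Dense (Submodule.span ℝ (Set.range x) : Set E) :=
      Submodule.dense_iff_topologicalClosure_eq_top.2 hx
    rwa [← Finsupp.range_linearCombination] at h1
  have hbound : ∀ c, ‖f c‖ ≤ 1 * ‖e c‖ := fun c => by rw [one_mul, hinner]
  have hext : ∀ c, f.extendOfNorm e (e c) = f c := fun c =>
    LinearMap.extendOfNorm_eq hdense ⟨1, hbound⟩ c
  refine ⟨⟨(f.extendOfNorm e).toLinearMap, fun v => ?_⟩, fun k => ?_⟩
  · refine hdense.induction_on (p := fun v => ‖f.extendOfNorm e v‖ = ‖v‖) v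
      (isClosed_eq (by fun_prop) (by fun_prop)) fun c => ?_
    rw [hext, hinner]
  · have h := hext (Finsupp.single k 1)
    simpa [e, f] using h

end Isometry

/-! ### Step functions in `L²([0,T])` -/

section StepFunctions

variable {T : ℝ}

/-- The step function `1_{(0,t]}` in `L²([0,T])`. -/
noncomputable def stepLp (t : Set.Icc (0 : ℝ) T) : Lp ℝ 2 (volume.restrict (Set.Icc (0 : ℝ) T)) :=
  indicatorConstLp 2 (measurableSet_Ioc (a := (0 : ℝ)) (b := t)) (measure_ne_top _ _) 1

theorem stepLp_ae_eq (t : Set.Icc (0 : ℝ) T) :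
    stepLp t =ᵐ[volume.restrict (Set.Icc (0 : ℝ) T)]
      (Set.Ioc (0 : ℝ) t).indicator fun _ => (1 : ℝ) := indicatorConstLp_coeFn

theorem inner_stepLp (s t : Set.Icc (0 : ℝ) T) : inner ℝ (stepLp s) (stepLp t) = min (s : ℝ) t := by
  rw [stepLp, stepLp, L2.real_inner_indicatorConstLp_one_indicatorConstLp_one, Set.Ioc_inter_Ioc,
    measureReal_restrict_apply measurableSet_Ioc, Set.inter_eq_left.2, max_self, Real.volume_real_Ioc,
    sub_zero, max_eq_left]
  · exact le_min s.2.1 t.2.1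
  · rintro x ⟨h1, h2⟩
    exact ⟨(le_max_left _ _).trans h1.le, h2.trans ((min_le_left _ _).trans s.2.2)⟩

/-- On `[0,T]` the half-line indicators agree with step functions or with zero, up to the null set
`{0}`. Half-lines form a π-system generating the Borel sets, so the monotone class argument applies.
-/
theorem span_stepLp_eq_top (hT : 0 ≤ T) :
    (Submodule.span ℝ (Set.range (stepLp (T := T)))).topologicalClosure = ⊤ := by
  let V := (Submodule.span ℝ (Set.range (stepLp (T := T)))).topologicalClosure
  have hV : IsClosed (V : Set (Lp ℝ 2 (volume.restrict (Set.Icc (0 : ℝ) T)))) :=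
    Submodule.isClosed_topologicalClosure _
  have hstep : ∀ t, stepLp (T := T) t ∈ V := fun t =>
    Submodule.le_topologicalClosure _ (Submodule.subset_span ⟨t, rfl⟩)
  have h0 : ∀ᵐ s ∂(volume.restrict (Set.Icc (0 : ℝ) T)), s ∈ Set.Icc 0 T ∧ s ≠ 0 := by
    refine (ae_restrict_mem measurableSet_Icc).and (ae_restrict_of_ae ?_)
    exact Measure.ae_ne volume 0
  have hIic : ∀ a : ℝ, (Set.Iic a).indicator (fun _ => (1 : ℝ)) ∈ aeSubmodule V := by
    intro a
    rcases lt_or_ge a 0 with ha | ha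
    · refine mem_aeSubmodule_congr (zero_mem _) ?_
      filter_upwards [h0] with s hs
      rw [Set.indicator_of_notMem (by simpa using ha.trans_le hs.1.1)]
      rfl
    · refine ⟨_, hstep ⟨min a T, le_min ha hT, min_le_right _ _⟩, (stepLp_ae_eq _).trans ?_⟩
      filter_upwards [h0] with s hs
      have hs0 : 0 < s := lt_of_le_of_ne hs.1.1 hs.2.symm
      by_cases h : s ≤ a
      · rw [Set.indicator_of_mem (by exact ⟨hs0, le_min h hs.1.2⟩),
          Set.indicator_of_mem (by exact h)]
      · rw [Set.indicator_of_notMem (by exact fun h' => h (h'.2.trans (min_le_left _ _))),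
          Set.indicator_of_notMem (by exact h)]
  have hone : (fun _ => (1 : ℝ)) ∈ aeSubmodule V := by
    refine mem_aeSubmodule_congr (hIic T) ?_
    filter_upwards [h0] with s hs
    exact Set.indicator_of_mem (by exact hs.1.2) _
  have hle : lpMeas ℝ ℝ (inferInstance : MeasurableSpace ℝ) 2 _ ≤ V := by
    refine lpMeas_le_of_indicator_mem ENNReal.ofNat_ne_top hV fun s hs => ?_
    refine indicator_mem_aeSubmodule_of_isPiSystem ENNReal.ofNat_ne_top hV
      (C := Set.range Set.Iic) isPiSystem_Iic hone ?_ ?_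
    · rintro _ ⟨a, rfl⟩
      exact ⟨measurableSet_Iic, hIic a⟩
    · rwa [← borel_eq_generateFrom_Iic ℝ, ← BorelSpace.measurable_eq]
  exact eq_top_iff.2 fun f _ => hle (mem_lpMeas_self _ f)

/-- The linear combination of the increments of `x` that corresponds to the integrand `φ`. -/
noncomputable def ElementaryIntegrand.combination {M : Type*} [AddCommGroup M] [Module ℝ M]
    (φ : ElementaryIntegrand T) (x : Set.Icc (0 : ℝ) T → M) : M :=
  ∑ k, φ.c k • (x (φ.t k.succ) - x (φ.t k.castSucc))

/-- A telescoping sum stopped at `j`, kept over all of `Fin n` so that the sums over `j` and `k` can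
be exchanged. -/
theorem sum_castSucc_lt {M : Type*} [AddCommGroup M] {n : ℕ} (y : Fin (n + 1) → M)
    (j : Fin (n + 1)) :
    (∑ k : Fin n, if k.castSucc < j then y k.succ - y k.castSucc else 0) = y j - y 0 := by
  induction j using Fin.induction with
  | zero => simp
  | succ i ih =>
    have h : ∀ k : Fin n, (if k.castSucc < i.succ then y k.succ - y k.castSucc else 0)
        = (if k.castSucc < i.castSucc then y k.succ - y k.castSucc else 0)
          + if k = i then y k.succ - y k.castSucc else 0 := by
      intro k
      rcases lt_trichotomy k i with h | h | h
      · simp [Fin.lt_def, h.ne, Nat.lt_succ_of_lt (Fin.lt_def.1 h), Fin.lt_def.1 h]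
      · subst h; simp [Fin.lt_def]
      · have h1 : ¬ k.castSucc < i.succ := by
          simp only [Fin.lt_def, Fin.val_castSucc, Fin.val_succ, not_lt]
          exact Fin.lt_def.1 h
        simp [h1, h.ne', h.le]
    rw [Finset.sum_congr rfl fun k _ => h k, Finset.sum_add_distrib, ih]
    simp

/-- Every linear combination of values of `x` is given by an elementary integrand. -/
theorem exists_combination_eq {M : Type*} [AddCommGroup M] [Module ℝ M] (hT : 0 ≤ T)
    (x : Set.Icc (0 : ℝ) T → M) (hx : x ⟨0, Set.left_mem_Icc.2 hT⟩ = 0)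
    (c : Set.Icc (0 : ℝ) T →₀ ℝ) :
    ∃ φ : ElementaryIntegrand T, φ.combination x = Finsupp.linearCombination ℝ x c := by
  classical
  let z : Set.Icc (0 : ℝ) T := ⟨0, Set.left_mem_Icc.2 hT⟩
  -- Adding `0` to the support makes the grid start where `x` vanishes and rules out an empty grid.
  let S := insert z c.support
  obtain ⟨n, hn⟩ : ∃ n, S.card = n + 1 :=
    Nat.exists_eq_succ_of_ne_zero (Finset.card_ne_zero_of_mem (Finset.mem_insert_self _ _))
  let t := S.orderEmbOfFin hn
  have ht0 : t 0 = z := by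
    have h1 : z ∈ Set.range t := by
      rw [Finset.range_orderEmbOfFin]
      exact Finset.mem_insert_self _ _
    obtain ⟨j, hj⟩ := h1
    refine le_antisymm ?_ (t 0).2.1
    rw [← hj]
    exact t.monotone (Fin.zero_le j)
  -- Abel summation: the weight on the increment from `t_k` to `t_{k+1}` is the total coefficient of
  -- all later grid points.
  refine ⟨⟨n, t, t.monotone, fun k => ∑ j, if k.castSucc < j then c (t j) else 0⟩, ?_⟩
  have h2 : Finsupp.linearCombination ℝ x c = ∑ j, c (t j) • x (t j) := by
    rw [Finsupp.linearCombination_apply,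
      Finsupp.sum_of_support_subset c (Finset.subset_insert z c.support) _ (by simp)]
    change ∑ s ∈ S, c s • x s = _
    rw [← Finset.map_orderEmbOfFin_univ S hn, Finset.sum_map]
    rfl
  have h3 : ∀ j, x (t j) = ∑ k : Fin n, if k.castSucc < j then x (t k.succ) - x (t k.castSucc)
      else 0 := fun j => by
    rw [sum_castSucc_lt (fun k => x (t k)) j, ht0, hx, sub_zero]
  rw [h2, ElementaryIntegrand.combination]
  simp only [Finset.sum_smul]
  rw [Finset.sum_comm]
  refine Finset.sum_congr rfl fun j _ => ?_
  rw [h3 j, Finset.smul_sum]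
  refine Finset.sum_congr rfl fun k _ => ?_
  split_ifs <;> simp

theorem coeFn_sum_ae_eq {Ω ι : Type*} {mΩ : MeasurableSpace Ω} {P : Measure Ω} {p : ℝ≥0∞}
    (s : Finset ι) {v : ι → Lp ℝ p P} {f : ι → Ω → ℝ} (h : ∀ i ∈ s, v i =ᵐ[P] f i) :
    (∑ i ∈ s, v i : Lp ℝ p P) =ᵐ[P] ∑ i ∈ s, f i := by
  classical
  induction s using Finset.induction_on with
  | empty => exact Lp.coeFn_zero _ _ _
  | insert a s ha ih =>
    rw [Finset.sum_insert ha, Finset.sum_insert ha]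
    exact (Lp.coeFn_add _ _).trans ((h a (Finset.mem_insert_self _ _)).add
      (ih fun i hi => h i (Finset.mem_insert_of_mem hi)))

theorem ElementaryIntegrand.combination_ae_eq {Ω : Type*} {mΩ : MeasurableSpace Ω} {P : Measure Ω}
    {p : ℝ≥0∞} (φ : ElementaryIntegrand T) {v : Set.Icc (0 : ℝ) T → Lp ℝ p P}
    {f : Set.Icc (0 : ℝ) T → Ω → ℝ} (h : ∀ t, v t =ᵐ[P] f t) :
    (φ.combination v : Lp ℝ p P) =ᵐ[P] fun ω => φ.combination fun t => f t ω := by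
  refine (coeFn_sum_ae_eq _ (f := fun k => φ.c k • (f (φ.t k.succ) - f (φ.t k.castSucc)))
    fun k _ => ?_).trans (EventuallyEq.of_eq ?_)
  · exact (Lp.coeFn_smul _ _).trans (((Lp.coeFn_sub _ _).trans ((h _).sub (h _))).const_smul _)
  · ext ω
    simp [combination]

theorem ElementaryIntegrand.combination_stepLp_ae_eq (φ : ElementaryIntegrand T) :
    (φ.combination stepLp : Lp ℝ 2 (volume.restrict (Set.Icc (0 : ℝ) T)))
      =ᵐ[volume.restrict (Set.Icc (0 : ℝ) T)] φ.toFun := by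
  refine (φ.combination_ae_eq stepLp_ae_eq).trans (EventuallyEq.of_eq (funext fun s => ?_))
  refine Finset.sum_congr rfl fun k _ => ?_
  have h0 : (0 : ℝ) ≤ φ.t k.castSucc := (φ.t k.castSucc).2.1
  have h1 : (φ.t k.castSucc : ℝ) ≤ φ.t k.succ := φ.mono (Fin.castSucc_le_succ k)
  simp only [Set.indicator, Set.mem_Ioc, smul_eq_mul]
  split_ifs <;> grind

end StepFunctions

/-! ### The stochastic integral as an isometry -/

section StochasticIntegral

variable {Ω : Type*} {mΩ : MeasurableSpace Ω} {P : Measure Ω}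
  {T : ℝ} {B : Set.Icc (0 : ℝ) T → Ω → ℝ}

/-- The Itô isometry for deterministic integrands. -/
theorem exists_itoIsometry (hT : 0 ≤ T) (hB : ∀ t, MemLp (B t) 2 P)
    (hcov : ∀ s t, ∫ ω, B s ω * B t ω ∂P = min (s : ℝ) t) :
    ∃ J : Lp ℝ 2 (volume.restrict (Set.Icc (0 : ℝ) T)) →ₗᵢ[ℝ] Lp ℝ 2 P,
      ∀ t, J (stepLp t) = (hB t).toLp (B t) :=
  exists_linearIsometry_of_gram_eq _ _
    (fun s t => by
      rw [inner_stepLp, inner_eq_integral_mul (hB s).coeFn_toLp (hB t).coeFn_toLp, hcov])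
    (span_stepLp_eq_top hT)

variable (hB : ∀ t, MemLp (B t) 2 P)
  {J : Lp ℝ 2 (volume.restrict (Set.Icc (0 : ℝ) T)) →ₗᵢ[ℝ] Lp ℝ 2 P}
  (hJ : ∀ t, J (stepLp t) = (hB t).toLp (B t))
include hJ

theorem itoIsometry_combination_ae_eq (φ : ElementaryIntegrand T) :
    J (φ.combination stepLp) =ᵐ[P] φ.integral B := by
  have h : J (φ.combination stepLp) = φ.combination fun t => (hB t).toLp (B t) := by
    simp only [ElementaryIntegrand.combination, map_sum, map_smul, map_sub, hJ]
  rw [h]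
  exact φ.combination_ae_eq fun t => (hB t).coeFn_toLp

theorem tendsto_integral_iff {X : Ω → ℝ}
    {Y : Lp ℝ 2 P} (hY : Y =ᵐ[P] X) (φ : ℕ → ElementaryIntegrand T) :
    Tendsto (fun m => eLpNorm (fun ω => (φ m).integral B ω - X ω) 2 P) atTop (𝓝 0) ↔
      Tendsto (fun m => J ((φ m).combination stepLp)) atTop (𝓝 Y) := by
  rw [Lp.tendsto_Lp_iff_tendsto_eLpNorm']
  refine iff_of_eq (congrArg (fun F => Tendsto F atTop (𝓝 0)) (funext fun m => ?_))
  exact eLpNorm_congr_ae ((itoIsometry_combination_ae_eq hB hJ (φ m)).sub hY).symm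

omit hJ in
theorem tendsto_toFun_iff {G : Lp ℝ 2 (volume.restrict (Set.Icc (0 : ℝ) T))} {g : ℝ → ℝ}
    (hG : G =ᵐ[volume.restrict (Set.Icc (0 : ℝ) T)] g) (φ : ℕ → ElementaryIntegrand T) :
    Tendsto (fun m => eLpNorm (fun s => (φ m).toFun s - g s) 2
      (volume.restrict (Set.Icc (0 : ℝ) T))) atTop (𝓝 0) ↔
      Tendsto (fun m => (φ m).combination stepLp) atTop (𝓝 G) := by
  rw [Lp.tendsto_Lp_iff_tendsto_eLpNorm']
  refine iff_of_eq (congrArg (fun F => Tendsto F atTop (𝓝 0)) (funext fun m => ?_))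
  exact eLpNorm_congr_ae (((φ m).combination_stepLp_ae_eq).sub hG).symm

theorem isStochasticIntegral_itoIsometry (hT : 0 ≤ T)
    {G : Lp ℝ 2 (volume.restrict (Set.Icc (0 : ℝ) T))} {g : ℝ → ℝ}
    (hG : G =ᵐ[volume.restrict (Set.Icc (0 : ℝ) T)] g) : IsStochasticIntegral P B g (J G) := by
  have hmem : G ∈ (Submodule.span ℝ (Set.range (stepLp (T := T)))).topologicalClosure := by
    rw [span_stepLp_eq_top hT]; trivial
  obtain ⟨w, hw, hlim⟩ := mem_closure_iff_seq_limit.1 hmem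
  have h0 : stepLp (⟨0, Set.left_mem_Icc.2 hT⟩ : Set.Icc (0 : ℝ) T) = 0 := by
    refine Lp.ext ((stepLp_ae_eq _).trans ((Lp.coeFn_zero _ _ _).trans ?_).symm)
    refine EventuallyEq.of_eq ?_
    simp
    rfl
  have hex : ∀ n, ∃ φ : ElementaryIntegrand T, φ.combination stepLp = w n := fun n => by
    obtain ⟨c, hc⟩ := (Finsupp.mem_span_range_iff_exists_finsupp).1 (hw n)
    obtain ⟨φ, hφ⟩ := exists_combination_eq hT stepLp h0 c
    exact ⟨φ, hφ.trans hc⟩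
  choose φ hφ using hex
  have hlim' : Tendsto (fun m => (φ m).combination stepLp) atTop (𝓝 G) := by simpa only [hφ] using hlim
  exact ⟨Lp.memLp _, φ, (tendsto_toFun_iff hG φ).2 hlim',
    (tendsto_integral_iff hB hJ EventuallyEq.rfl φ).2 ((J.continuous.tendsto G).comp hlim')⟩

/-- Uniqueness: any approximating step functions converge to `G`, so their integrals converge to `J
G` by continuity, whatever sequence was chosen. -/
theorem IsStochasticIntegral.ae_eq {G : Lp ℝ 2 (volume.restrict (Set.Icc (0 : ℝ) T))} {g : ℝ → ℝ}
    (hG : G =ᵐ[volume.restrict (Set.Icc (0 : ℝ) T)] g) {X : Ω → ℝ}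
    (hX : IsStochasticIntegral P B g X) : X =ᵐ[P] J G := by
  obtain ⟨hX2, φ, h1, h2⟩ := hX
  have h3 := (tendsto_integral_iff hB hJ hX2.coeFn_toLp φ).1 h2
  have h4 := (J.continuous.tendsto G).comp ((tendsto_toFun_iff hG φ).1 h1)
  have h5 : J G = hX2.toLp X := tendsto_nhds_unique h4 h3
  rw [h5]
  exact hX2.coeFn_toLp.symm

theorem stochasticIntegral_ae_eq (hT : 0 ≤ T)
    {G : Lp ℝ 2 (volume.restrict (Set.Icc (0 : ℝ) T))} {g : ℝ → ℝ}
    (hG : G =ᵐ[volume.restrict (Set.Icc (0 : ℝ) T)] g) : stochasticIntegral P B g =ᵐ[P] J G := by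
  have h : ∃ X : Ω → ℝ, IsStochasticIntegral P B g X :=
    ⟨J G, isStochasticIntegral_itoIsometry hB hJ hT hG⟩
  rw [stochasticIntegral, dif_pos h]
  exact IsStochasticIntegral.ae_eq hB hJ hG h.choose_spec

end StochasticIntegral

/-! ### Density and orthonormal basis for an abstract Gaussian family -/

section Basis

variable {Ω κ : Type*} {m mΩ : MeasurableSpace Ω} {P : Measure Ω} [IsProbabilityMeasure P]
  {ξ : κ → Ω → ℝ}

omit [IsProbabilityMeasure P] in
theorem aestronglyMeasurable_wickPolynomial
    (hξm : ∀ k, AEStronglyMeasurable[m] (ξ k) P) (α : κ →₀ ℕ) :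
    AEStronglyMeasurable[m] (wickPolynomial ξ α) P := by
  have h : wickPolynomial ξ α = fun ω => (1 / Real.sqrt (multiFactorial α : ℝ)) *
      ∏ k ∈ α.support, (hermitePoly (α k)).eval (ξ k ω) := by
    ext ω
    simp only [wickPolynomial, Finsupp.prod, hermiteFun_eq_eval]
    rfl
  rw [h]
  refine AEStronglyMeasurable.const_mul ?_ _
  classical
  induction α.support using Finset.induction_on with
  | empty => simpa using aestronglyMeasurable_const
  | insert k s hk ih =>
    simp only [Finset.prod_insert hk]
    exact ((hermitePoly (α k)).continuous.comp_aestronglyMeasurable (hξm k)).mul ih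

/-- The Wick polynomials of a family of independent standard Gaussian variables span a dense
subspace of `L^p(m)` and form an orthonormal basis of `L²(m)`, if `m` is generated by elements of
the closed Gaussian space of the family. -/
theorem wickPolynomial_dense_and_basis (hmΩ : m ≤ mΩ) (hm : ∀ k, AEMeasurable[mΩ] (ξ k) P)
    (hind : iIndepFun ξ P) (hlaw : ∀ k, P.map (ξ k) = gaussianReal 0 1)
    (hξm : ∀ k, AEStronglyMeasurable[m] (ξ k) P)
    (hgen : m ≤ ⨆ (u : Ω → ℝ) (_ : Measurable[mΩ] u ∧ u ∈ aeSubmodule (gaussianSpace P ξ)),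
      MeasurableSpace.comap u inferInstance) :
    (∀ (p : ℝ≥0∞) [Fact (1 ≤ p)], p ≠ ∞ →
      ∃ x : (κ →₀ ℕ) → lpMeas ℝ ℝ m p P,
        (∀ α, ((x α : Lp ℝ p P) : Ω → ℝ) =ᵐ[P] wickPolynomial ξ α) ∧
        Dense (Submodule.span ℝ (Set.range x) : Set (lpMeas ℝ ℝ m p P))) ∧
    (∃ b : HilbertBasis (κ →₀ ℕ) ℝ (lpMeas ℝ ℝ m 2 P),
      ∀ α, ((b α : Lp ℝ 2 P) : Ω → ℝ) =ᵐ[P] wickPolynomial ξ α) := by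
  have hmem : ∀ (p : ℝ≥0∞), p ≠ ∞ → ∀ α, MemLp (wickPolynomial ξ α) p P := fun p hp α =>
    wickPolynomial_mem (fun k => mem_momentAlgebra_of_map_eq (hm k) (hlaw k)) α p hp
  have hfirst : ∀ (p : ℝ≥0∞) [Fact (1 ≤ p)], p ≠ ∞ →
      ∃ x : (κ →₀ ℕ) → lpMeas ℝ ℝ m p P,
        (∀ α, ((x α : Lp ℝ p P) : Ω → ℝ) =ᵐ[P] wickPolynomial ξ α) ∧
        Dense (Submodule.span ℝ (Set.range x) : Set (lpMeas ℝ ℝ m p P)) := by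
    intro p _ hp
    let x : (κ →₀ ℕ) → lpMeas ℝ ℝ m p P := fun α => ⟨(hmem p hp α).toLp _,
      mem_lpMeas_iff_aestronglyMeasurable.2
        ((aestronglyMeasurable_wickPolynomial hξm α).congr (hmem p hp α).coeFn_toLp.symm)⟩
    refine ⟨x, fun α => (hmem p hp α).coeFn_toLp, fun f => ?_⟩
    let S : Submodule ℝ (Lp ℝ p P) := Submodule.span ℝ (Set.range fun α => (x α : Lp ℝ p P))
    have hS : (fun v : lpMeas ℝ ℝ m p P => (v : Lp ℝ p P)) '' (Submodule.span ℝ (Set.range x)) = S := by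
      have h1 := Submodule.map_span (lpMeas ℝ ℝ m p P).subtype (Set.range x)
      rw [← Set.range_comp] at h1
      exact congrArg (fun V : Submodule ℝ (Lp ℝ p P) => (V : Set (Lp ℝ p P))) h1
    rw [closure_subtype, hS]
    -- Density inside the subspace of `m`-measurable classes is checked in the ambient `L^p`, where
    -- the closed span serves as `V`.
    have hle : lpMeas ℝ ℝ m p P ≤ S.topologicalClosure := by
      refine lpMeas_le_of_wickSpan_le hp (Submodule.isClosed_topologicalClosure _) hm hlaw
        (Submodule.span_le.2 ?_) hgen
      rintro _ ⟨α, rfl⟩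
      exact ⟨x α, Submodule.le_topologicalClosure _ (Submodule.subset_span ⟨α, rfl⟩),
        (hmem p hp α).coeFn_toLp⟩
    exact hle f.2
  refine ⟨hfirst, ?_⟩
  obtain ⟨x, hx, hdense⟩ := hfirst 2 ENNReal.ofNat_ne_top
  -- This makes the space of `m`-measurable classes complete, as a Hilbert basis requires.
  have : Fact (m ≤ mΩ) := ⟨hmΩ⟩
  have horth : Orthonormal ℝ x := by
    classical
    rw [orthonormal_iff_ite]
    intro α β
    rw [← integral_wickPolynomial_mul hm hind hlaw α β]
    exact inner_eq_integral_mul (hx α) (hx β)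
  refine ⟨HilbertBasis.mk horth (Submodule.dense_iff_topologicalClosure_eq_top.1 hdense).ge,
    fun α => ?_⟩
  rw [HilbertBasis.coe_mk]
  exact hx α

end Basis

/-! ### Measurability through coordinates in a separable Hilbert space -/

section HilbertSpace

variable {Z ι : Type*} [NormedAddCommGroup Z] [InnerProductSpace ℝ Z]
  [TopologicalSpace.SeparableSpace Z]

/-- Orthonormal vectors are at distance `√2`, so balls of radius `1/2` around them are disjoint open
sets in a separable space. -/
theorem countable_of_orthonormal {e : ι → Z} (he : Orthonormal ℝ e) : Countable ι := by
  refine Pairwise.countable_of_isOpen_disjoint (s := fun i => Metric.ball (e i) (1 / 2))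
    (fun i j hij => ?_) (fun i => Metric.isOpen_ball)
    (fun i => ⟨e i, Metric.mem_ball_self (by norm_num)⟩)
  refine Metric.ball_disjoint_ball ?_
  have h1 : ‖e i - e j‖ ^ 2 = 2 := by
    rw [norm_sub_sq_real, he.1 i, he.1 j, he.2 hij]
    norm_num
  rw [dist_eq_norm]
  nlinarith [norm_nonneg (e i - e j)]

theorem measurable_of_measurable_inner {Ω : Type*} [MeasurableSpace Ω] [MeasurableSpace Z]
    [BorelSpace Z] (e : HilbertBasis ι ℝ Z) {Y : Ω → Z}
    (h : ∀ i, Measurable fun ω => (inner ℝ (e i) (Y ω) : ℝ)) : Measurable Y := by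
  have : Countable ι := countable_of_orthonormal e.orthonormal
  have : SecondCountableTopology Z := UniformSpace.secondCountable_of_separable Z
  refine measurable_of_tendsto_metrizable' (atTop : Filter (Finset ι))
    (f := fun s ω => ∑ i ∈ s, (inner ℝ (e i) (Y ω) : ℝ) • e i)
    (fun s => Finset.measurable_fun_sum s fun i _ => (h i).smul_const (e i))
    (tendsto_pi_nhds.2 fun ω => ?_)
  have h1 := e.hasSum_repr (Y ω)
  simp only [e.repr_apply_apply] at h1
  exact h1

end HilbertSpace

/-! ### Range and orthogonality of Itô integrals -/

section Ito

variable {Ω : Type*} {mΩ : MeasurableSpace Ω} {P : Measure Ω} {T : ℝ}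
  {B : Set.Icc (0 : ℝ) T → Ω → ℝ}

/-- Step functions are total, so a property of the `B t` that defines a closed subspace is inherited
by all integrals. It is used for Gaussianity, measurability and orthogonality. -/
theorem itoIsometry_mem (hT : 0 ≤ T) (hB : ∀ t, MemLp (B t) 2 P)
    {J : Lp ℝ 2 (volume.restrict (Set.Icc (0 : ℝ) T)) →ₗᵢ[ℝ] Lp ℝ 2 P}
    (hJ : ∀ t, J (stepLp t) = (hB t).toLp (B t)) {V : Submodule ℝ (Lp ℝ 2 P)}
    (hV : IsClosed (V : Set (Lp ℝ 2 P))) (h : ∀ t, (hB t).toLp (B t) ∈ V)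
    (f : Lp ℝ 2 (volume.restrict (Set.Icc (0 : ℝ) T))) : J f ∈ V := by
  have h1 : (Submodule.span ℝ (Set.range (stepLp (T := T)))).topologicalClosure
      ≤ V.comap J.toLinearMap := by
    refine Submodule.topologicalClosure_minimal _ (Submodule.span_le.2 ?_)
      (hV.preimage J.continuous)
    rintro _ ⟨t, rfl⟩
    change J (stepLp t) ∈ V
    rw [hJ]
    exact h t
  rw [span_stepLp_eq_top hT] at h1
  exact h1 (Submodule.mem_top (x := f))

/-- Itô integrals with respect to uncorrelated processes are orthogonal. -/
theorem inner_itoIsometry_eq_zero (hT : 0 ≤ T) {B' : Set.Icc (0 : ℝ) T → Ω → ℝ}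
    (hB : ∀ t, MemLp (B t) 2 P) (hB' : ∀ t, MemLp (B' t) 2 P)
    {J J' : Lp ℝ 2 (volume.restrict (Set.Icc (0 : ℝ) T)) →ₗᵢ[ℝ] Lp ℝ 2 P}
    (hJ : ∀ t, J (stepLp t) = (hB t).toLp (B t)) (hJ' : ∀ t, J' (stepLp t) = (hB' t).toLp (B' t))
    (horth : ∀ s t, ∫ ω, B s ω * B' t ω ∂P = 0)
    (f f' : Lp ℝ 2 (volume.restrict (Set.Icc (0 : ℝ) T))) : inner ℝ (J f) (J' f') = 0 := by
  have h1 : ∀ t f', inner ℝ ((hB t).toLp (B t)) (J' f') = 0 := fun t f' => by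
    rw [← Submodule.mem_orthogonal_singleton_iff_inner_right]
    refine itoIsometry_mem hT hB' hJ' (Submodule.isClosed_orthogonal _) (fun s => ?_) f'
    rw [Submodule.mem_orthogonal_singleton_iff_inner_right,
      inner_eq_integral_mul (hB t).coeFn_toLp (hB' s).coeFn_toLp, horth]
  rw [← Submodule.mem_orthogonal_singleton_iff_inner_left]
  refine itoIsometry_mem hT hB hJ (Submodule.isClosed_orthogonal _) (fun s => ?_) f
  rw [Submodule.mem_orthogonal_singleton_iff_inner_left, h1]

end Ito

/-! ### The terminal σ-algebra -/

section Filtration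

variable {Ω Z : Type*} {mΩ : MeasurableSpace Ω} {P : Measure Ω} [MeasurableSpace Z] {T : ℝ}
  {W : Set.Icc (0 : ℝ) T → Ω → Z}

/-- There is no time after `T`, so taking right limits changes nothing there. -/
theorem augmentedFiltration_terminal (hT : 0 ≤ T) (hW : ∀ t, Measurable (W t)) :
    augmentedFiltration P W hW ⟨T, Set.right_mem_Icc.2 hT⟩
      = completedFiltration P W hW ⟨T, Set.right_mem_Icc.2 hT⟩ := by
  have hmax : IsMax (⟨T, Set.right_mem_Icc.2 hT⟩ : Set.Icc (0 : ℝ) T) := fun t _ => t.2.2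
  rw [augmentedFiltration, Filtration.rightCont_eq_of_isMax _ hmax]

theorem measurable_completedFiltration (hT : 0 ≤ T) (hW : ∀ t, Measurable (W t))
    (t : Set.Icc (0 : ℝ) T) :
    Measurable[completedFiltration P W hW ⟨T, Set.right_mem_Icc.2 hT⟩] (W t) := by
  rw [measurable_iff_comap_le]
  exact le_sup_of_le_left (le_iSup₂_of_le t t.2.2 le_rfl)

theorem completedFiltration_le (hW : ∀ t, Measurable (W t)) {m : MeasurableSpace Ω}
    (h1 : ∀ t, Measurable[m] (W t)) (h2 : ∀ N, MeasurableSet[mΩ] N → P N = 0 → MeasurableSet[m] N)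
    (t : Set.Icc (0 : ℝ) T) : completedFiltration P W hW t ≤ m :=
  sup_le (iSup₂_le fun s _ => measurable_iff_comap_le.1 (h1 s))
    (MeasurableSpace.generateFrom_le fun N hN => h2 N hN.1 hN.2)

end Filtration

/-! ### Coordinate Brownian motions -/

section Coordinates

variable {Ω Z : Type*} {mΩ : MeasurableSpace Ω} {P : Measure Ω} [IsProbabilityMeasure P]
  [NormedAddCommGroup Z] [InnerProductSpace ℝ Z] [MeasurableSpace Z] [BorelSpace Z]
  [TopologicalSpace.SeparableSpace Z] [CompleteSpace Z]
  {T : ℝ} {Q : Z →L[ℝ] Z} {W : Set.Icc (0 : ℝ) T → Ω → Z}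

omit [MeasurableSpace Z] [BorelSpace Z] [TopologicalSpace.SeparableSpace Z] [CompleteSpace Z] in
theorem coordProcess_eq_inner (l : ℝ) (e : Z) (t : Set.Icc (0 : ℝ) T) :
    coordProcess W l e t = fun ω : Ω => inner ℝ ((1 / Real.sqrt l) • e) (W t ω) := by
  ext ω
  rw [coordProcess, real_inner_smul_left, real_inner_comm]

theorem IsQBrownianMotion.integral_coordProcess_mul {ι : Type*} (hT : 0 ≤ T) (hQ : Q.IsPositive)
    (hW : IsQBrownianMotion P Q W) (e : HilbertBasis ι ℝ Z) {lam : ι → ℝ}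
    (he : ∀ i, Q (e i) = lam i • e i) {i j : ι} (hi : 0 < lam i) [Decidable (i = j)]
    (s t : Set.Icc (0 : ℝ) T) :
    ∫ ω, coordProcess W (lam i) (e i) s ω * coordProcess W (lam j) (e j) t ω ∂P
      = if i = j then min (s : ℝ) t else 0 := by
  simp only [coordProcess_eq_inner]
  rw [hW.integral_inner_mul hT hQ]
  simp only [map_smul, he, real_inner_smul_left, real_inner_smul_right]
  split_ifs with h
  · subst h
    rw [real_inner_self_eq_norm_sq, e.orthonormal.1]
    have h1 : Real.sqrt (lam i) * Real.sqrt (lam i) = lam i := Real.mul_self_sqrt hi.le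
    have h2 : Real.sqrt (lam i) ≠ 0 := (Real.sqrt_pos.2 hi).ne'
    field_simp
    rw [sq, h1]
  · rw [e.orthonormal.2 h]
    simp

end Coordinates

/-! ### Assembly for the `Q`-Brownian motion -/

theorem IsQBrownianMotion.wickPolynomial_dense_and_hilbertBasis {Ω Z ι : Type*} {mΩ : MeasurableSpace Ω} (P : Measure Ω)
    [IsProbabilityMeasure P] [NormedAddCommGroup Z] [InnerProductSpace ℝ Z] [CompleteSpace Z]
    [TopologicalSpace.SeparableSpace Z] [MeasurableSpace Z] [BorelSpace Z]
    (T : ℝ) (hT : 0 < T)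
    (Q : Z →L[ℝ] Z) (hQpos : Q.IsPositive)
    (W : Set.Icc (0 : ℝ) T → Ω → Z) (hW : IsQBrownianMotion P Q W)
    (e : HilbertBasis ι ℝ Z) (lam : ι → ℝ) (he : ∀ i, Q (e i) = lam i • e i)
    (g : ℕ → ℝ → ℝ)
    (gbasis : HilbertBasis ℕ ℝ (Lp ℝ 2 (volume.restrict (Set.Icc (0 : ℝ) T))))
    (hg : ∀ j, (gbasis j : ℝ → ℝ) =ᵐ[volume.restrict (Set.Icc (0 : ℝ) T)] g j) :
    (∀ (p : ℝ≥0∞) [Fact (1 ≤ p)], p ≠ ∞ →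
      ∃ x : (({i : ι // 0 < lam i} × ℕ) →₀ ℕ) →
          lpMeas ℝ ℝ (augmentedFiltration P W hW.measurable
            ⟨T, Set.right_mem_Icc.2 hT.le⟩) p P,
        (∀ α, ((x α : Lp ℝ p P) : Ω → ℝ) =ᵐ[P]
          wickPolynomial (gaussianCoord P W lam e g) α) ∧
        Dense (Submodule.span ℝ (Set.range x) :
          Set (lpMeas ℝ ℝ (augmentedFiltration P W hW.measurable
            ⟨T, Set.right_mem_Icc.2 hT.le⟩) p P))) ∧
    (∃ b : HilbertBasis (({i : ι // 0 < lam i} × ℕ) →₀ ℕ) ℝ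
        (lpMeas ℝ ℝ (augmentedFiltration P W hW.measurable
          ⟨T, Set.right_mem_Icc.2 hT.le⟩) 2 P),
      ∀ α, ((b α : Lp ℝ 2 P) : Ω → ℝ) =ᵐ[P]
        wickPolynomial (gaussianCoord P W lam e g) α) := by
  have hT0 : 0 ≤ T := hT.le
  let B : {i : ι // 0 < lam i} → Set.Icc (0 : ℝ) T → Ω → ℝ := fun i =>
    coordProcess W (lam i) (e i)
  let X : Set.Icc (0 : ℝ) T × Z → Ω → ℝ := fun k ω => inner ℝ k.2 (W k.1 ω)
  let ξ := gaussianCoord P W lam e g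
  have hX : IsGaussianProcess X P := hW.isGaussianProcess hT0 hQpos
  have hXmean : ∀ k, ∫ ω, X k ω ∂P = 0 := fun k => hW.integral_inner hT0 hQpos k.1 k.2
  have hX2 : ∀ k, MemLp (X k) 2 P := fun k => hW.memLp_inner hT0 hQpos k.1 k.2
  have hBX : ∀ i t, B i t = X (t, (1 / Real.sqrt (lam i)) • e i) := fun i t =>
    coordProcess_eq_inner _ _ t
  have hB2 : ∀ i t, MemLp (B i t) 2 P := fun i t => by rw [hBX]; exact hX2 _
  have hBcov : ∀ (i : {i : ι // 0 < lam i}) s t, ∫ ω, B i s ω * B i t ω ∂P = min (s : ℝ) t := by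
    classical
    intro i s t
    simpa using! hW.integral_coordProcess_mul hT0 hQpos e he (j := i) i.2 s t
  have hBorth : ∀ (i j : {i : ι // 0 < lam i}), i ≠ j → ∀ s t, ∫ ω, B i s ω * B j t ω ∂P = 0 := by
    classical
    intro i j hij s t
    have h := hW.integral_coordProcess_mul hT0 hQpos e he (j := j) i.2 s t
    rwa [if_neg fun h' => hij (Subtype.ext h')] at h
  choose J hJ using fun i => exists_itoIsometry hT0 (hB2 i) (hBcov i)
  have hξJ : ∀ k, J k.1 (gbasis k.2) =ᵐ[P] ξ k := fun k =>
    (stochasticIntegral_ae_eq (hB2 k.1) (hJ k.1) hT0 (hg k.2)).symm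
  -- Placing all `ξ_k` in one Gaussian space makes them jointly Gaussian, so their laws and
  -- independence follow from second moments.
  have hξX : ∀ k, ξ k ∈ aeSubmodule (gaussianSpace P X) := fun k => by
    refine ⟨_, itoIsometry_mem hT0 (hB2 k.1) (hJ k.1) gaussianSpace_isClosed (fun t => ?_) _, hξJ k⟩
    refine toLp_mem_of_mem_aeSubmodule ?_ _
    rw [hBX]
    exact mem_gaussianSpace hX2 _
  have hξ2 : ∀ k, MemLp (ξ k) 2 P := fun k => memLp_of_mem_aeSubmodule (hξX k)
  have hm : ∀ k, AEMeasurable (ξ k) P := fun k => (hξ2 k).1.aemeasurable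
  have hlaw : ∀ k, P.map (ξ k) = gaussianReal 0 1 := fun k => by
    rw [map_eq_of_mem_gaussianSpace hX hXmean (hξX k), ← norm_sq_eq_integral (hξJ k),
      LinearIsometry.norm_map, gbasis.orthonormal.1]
    simp
  have hind : iIndepFun ξ P := by
    refine iIndepFun_of_mem_gaussianSpace hX hXmean hξX fun k l hkl => ?_
    rw [← inner_eq_integral_mul (hξJ k) (hξJ l)]
    -- Within one coordinate, orthogonality comes from the basis `(g_j)` and the isometry; across
    -- coordinates, from the uncorrelated processes.
    by_cases h1 : k.1 = l.1
    · rw [h1, LinearIsometry.inner_map_map]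
      exact gbasis.orthonormal.2 fun h2 => hkl (Prod.ext h1 h2)
    · exact inner_itoIsometry_eq_zero hT0 (hB2 _) (hB2 _) (hJ _) (hJ _) (hBorth _ _ h1) _ _
  have hWm := hW.measurable
  -- The converse inclusion, where completeness of `(g_j)` enters: `B i t` is the integral of a step
  -- function, which is an `L²` limit of combinations of the `g_j`.
  have hWξ : ∀ i t, (fun ω => (inner ℝ (e i) (W t ω) : ℝ)) ∈ aeSubmodule (gaussianSpace P ξ) := by
    intro i t
    rcases lt_or_ge 0 (lam i) with hi | hi
    · have h1 : ∀ f, J ⟨i, hi⟩ f ∈ gaussianSpace P ξ := fun f => by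
        have h2 : (Submodule.span ℝ (Set.range gbasis)).topologicalClosure
            ≤ (gaussianSpace P ξ).comap (J ⟨i, hi⟩).toLinearMap := by
          refine Submodule.topologicalClosure_minimal _ (Submodule.span_le.2 ?_)
            (gaussianSpace_isClosed.preimage (J ⟨i, hi⟩).continuous)
          rintro _ ⟨j, rfl⟩
          exact (coeFn_mem_aeSubmodule (v := J ⟨i, hi⟩ (gbasis j))).1
            (mem_aeSubmodule_congr (mem_gaussianSpace hξ2 (⟨i, hi⟩, j)) (hξJ (⟨i, hi⟩, j)).symm)
        rw [gbasis.dense_span] at h2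
        exact h2 (Submodule.mem_top (x := f))
      have h3 : B ⟨i, hi⟩ t ∈ aeSubmodule (gaussianSpace P ξ) :=
        mem_aeSubmodule_of_toLp_mem (hB2 ⟨i, hi⟩ t) (by rw [← hJ]; exact h1 _)
      have h4 : (fun ω => (inner ℝ (e i) (W t ω) : ℝ)) = Real.sqrt (lam i) • B ⟨i, hi⟩ t := by
        ext ω
        have h5 : Real.sqrt (lam i) ≠ 0 := (Real.sqrt_pos.2 hi).ne'
        simp only [B, coordProcess_eq_inner, Pi.smul_apply, smul_eq_mul, real_inner_smul_left]
        field_simp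
      rw [h4]
      exact Submodule.smul_mem _ _ h3
    -- Positivity forces `λ_i = 0` here, so this coordinate has zero second moment and vanishes a.s.
    · have h1 := hW.integral_inner_sq hT0 hQpos t (e i)
      have h2 : lam i = 0 := by
        refine le_antisymm hi ?_
        have h3 := hQpos.inner_nonneg_left (e i)
        rwa [he, real_inner_smul_left, real_inner_self_eq_norm_sq, e.orthonormal.1, one_pow,
          mul_one] at h3
      rw [he, h2, zero_smul, inner_zero_left, mul_zero,
        integral_eq_zero_iff_of_nonneg (fun ω => sq_nonneg _)
          (hW.memLp_inner hT0 hQpos t (e i)).integrable_sq] at h1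
      refine mem_aeSubmodule_congr (zero_mem _) ?_
      filter_upwards [h1] with ω hω
      exact (pow_eq_zero_iff two_ne_zero |>.1 hω).symm
  rw [augmentedFiltration_terminal hT0 hWm]
  refine wickPolynomial_dense_and_basis (Filtration.le _ _) hm hind hlaw (fun k => ?_) ?_
  · have h1 := itoIsometry_mem hT0 (hB2 k.1) (hJ k.1)
      (V := lpMeas ℝ ℝ (completedFiltration P W hWm ⟨T, Set.right_mem_Icc.2 hT0⟩) 2 P)
      (isClosed_aestronglyMeasurable (Filtration.le _ _)) (fun t => ?_) (gbasis k.2)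
    · exact (mem_lpMeas_iff_aestronglyMeasurable.1 h1).congr (hξJ k)
    · refine mem_lpMeas_iff_aestronglyMeasurable.2
        (AEStronglyMeasurable.congr ?_ (hB2 k.1 t).coeFn_toLp.symm)
      rw [hBX]
      refine StronglyMeasurable.aestronglyMeasurable (Measurable.stronglyMeasurable ?_)
      exact (continuous_const.inner continuous_id).measurable.comp
        (measurable_completedFiltration hT0 hWm t)
  · refine completedFiltration_le hWm (fun t => ?_) (fun N hN hN0 => ?_) _
    · refine @measurable_of_measurable_inner Z ι _ _ _ Ω (_) _ _ e _ fun i => ?_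
      rw [measurable_iff_comap_le]
      refine le_iSup₂_of_le (fun ω => (inner ℝ (e i) (W t ω) : ℝ)) ⟨?_, hWξ i t⟩ le_rfl
      exact (continuous_const.inner continuous_id).measurable.comp (hWm t)
    · have h1 : MeasurableSpace.comap (N.indicator fun _ => (1 : ℝ)) inferInstance
          ≤ ⨆ (u : Ω → ℝ) (_ : Measurable u ∧ u ∈ aeSubmodule (gaussianSpace P ξ)),
            MeasurableSpace.comap u inferInstance := by
        refine le_iSup₂_of_le _ ⟨measurable_const.indicator hN, ?_⟩ le_rfl
        refine mem_aeSubmodule_congr (zero_mem _) ?_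
        exact (indicator_meas_zero hN0).symm
      -- A null set is the preimage of `{1}` under its indicator, an a.e. zero function and hence an
      -- admissible generator.
      refine h1 N ⟨{1}, measurableSet_singleton 1, ?_⟩
      ext ω
      by_cases h : ω ∈ N <;> simp [h]

end WienerChaos

theorem mainTheorem8 {Ω Z ι : Type*} {mΩ : MeasurableSpace Ω} (P : Measure Ω)
    [IsProbabilityMeasure P] [NormedAddCommGroup Z] [InnerProductSpace ℝ Z] [CompleteSpace Z]
    [TopologicalSpace.SeparableSpace Z] [MeasurableSpace Z] [BorelSpace Z]
    (T : ℝ) (hT : 0 < T)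
    (Q : Z →L[ℝ] Z) (hQpos : Q.IsPositive) (hQnuc : WienerChaos.IsNuclear Q)
    (W : Set.Icc (0 : ℝ) T → Ω → Z) (hW : WienerChaos.IsQBrownianMotion P Q W)
    (e : HilbertBasis ι ℝ Z) (lam : ι → ℝ) (he : ∀ i, Q (e i) = lam i • e i)
    (g : ℕ → ℝ → ℝ)
    (hgcont : ∀ j, ∀ᵐ t ∂(volume.restrict (Set.Icc (0 : ℝ) T)), ContinuousAt (g j) t)
    (gbasis : HilbertBasis ℕ ℝ (Lp ℝ 2 (volume.restrict (Set.Icc (0 : ℝ) T))))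
    (hg : ∀ j, (gbasis j : ℝ → ℝ) =ᵐ[volume.restrict (Set.Icc (0 : ℝ) T)] g j) :
    (∀ (p : ℝ≥0∞) [Fact (1 ≤ p)], p ≠ ∞ →
      ∃ x : (({i : ι // 0 < lam i} × ℕ) →₀ ℕ) →
          lpMeas ℝ ℝ (WienerChaos.augmentedFiltration P W hW.measurable
            ⟨T, Set.right_mem_Icc.2 hT.le⟩) p P,
        (∀ α, ((x α : Lp ℝ p P) : Ω → ℝ) =ᵐ[P]
          WienerChaos.wickPolynomial (WienerChaos.gaussianCoord P W lam e g) α) ∧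
        Dense (Submodule.span ℝ (Set.range x) :
          Set (lpMeas ℝ ℝ (WienerChaos.augmentedFiltration P W hW.measurable
            ⟨T, Set.right_mem_Icc.2 hT.le⟩) p P))) ∧
    (∃ b : HilbertBasis (({i : ι // 0 < lam i} × ℕ) →₀ ℕ) ℝ
        (lpMeas ℝ ℝ (WienerChaos.augmentedFiltration P W hW.measurable
          ⟨T, Set.right_mem_Icc.2 hT.le⟩) 2 P),
      ∀ α, ((b α : Lp ℝ 2 P) : Ω → ℝ) =ᵐ[P]
        WienerChaos.wickPolynomial (WienerChaos.gaussianCoord P W lam e g) α) := by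
  exact WienerChaos.IsQBrownianMotion.wickPolynomial_dense_and_hilbertBasis P T hT Q hQpos W hW e lam he g gbasis hg
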